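/- Paths in a $2$-graph are composed like maps: $\lambda\mu$ is defined when $s(\lambda)=r(\mu)$. Consider the $2$-coloured directed graph with three vertices $u,v,w$ and, for each colour $c\in\{b,r\}$ (blue, red), six edges $e_c,f_c,g_c,h_c,\alpha_c,\beta_c$, where $e_c$ is a loop at $v$, $f_c$ is a loop at $u$, $g_c$ and $h_c$ are loops at $w$, $\alpha_c$ has range $v$ and source $u$, and $\beta_c$ has range $v$ and source $w$. Let $\Lambda$ be the category of paths of this graph modulo the factorisation rules $$e_be_r=e_re_b,\quad e_b\alpha_r=e_r\alpha_b,\quad e_b\beta_r=e_r\beta_b,\quad \alpha_bf_r=\alpha_rf_b,\quad f_bf_r=f_rf_b,\quad \beta_bg_r=\beta_rg_b,\quad \beta_bh_r=\beta_rh_b,$$ $$g_bg_r=g_rg_b,\quad g_bh_r=h_rg_b,\quad h_bg_r=g_rh_b,\quad h_bh_r=h_rh_b,$$ with the degree functor $d:\Lambda\to\mathbb N^2$ that gives blue edges degree $(1,0)$ and red edges degree $(0,1)$. Then: (1) $\Lambda$ is a row-finite $2$-graph with no sources (it is countable and has the unique factorisation property, and for every vertex $x$ and $n\in\mathbb N^2$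 the set of paths with range $x$ and degree $n$ is finite and non-empty), and its paths of degree $(1,0)$ and $(0,1)$ are exactly the given blue and red edges, all distinct. (2) Let $\Lambda^\infty$ be the space of infinite paths of $\Lambda$ (degree-preserving functors from $\Omega_2=\{(m,n)\in\mathbb N^2\times\mathbb N^2: m\le n\}$ to $\Lambda$), with shifts $\sigma^p$, and let $G_\Lambda=\{(x,p-q,y): x,y\in\Lambda^\infty,\ p,q\in\mathbb N^2,\ \sigma^p(x)=\sigma^q(y)\}$ be the infinite-path groupoid, in which $(x,n,y)$ has range $x$ and source $y$, with the topology generated by the sets $Z(\mu,\nu)=\{(\mu x,d(\mu)-d(\nu),\nu x): x\in s(\mu)\Lambda^\infty\}$ for $\mu,\nu\in\Lambda$ with $s(\mu)=s(\nu)$. Then the interior of the isotropy $\{\gamma\in G_\Lambda: r(\gamma)=s(\gamma)\}$ is not closed in $G_\Lambda$. (3) Let $C^*(\Lambda)$ be the universal $C^*$-algebra generated by a Cuntz--Krieger $\Lambda$-family $\{s_\lambda:\lambda\in\Lambda\}$, and let $M$ be the closed linear span of the elements $s_\mu s_\nu^*$ for which $s(\mu)=s(\nu)$ and $\mu x=\nu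 x$ for every $x\in s(\mu)\Lambda^\infty$. Then $M$ is a $C^*$-subalgebra and is maximal abelian in $C^*(\Lambda)$, but there is no conditional expectation of $C^*(\Lambda)$ onto $M$. In particular, $M$ is not a Cartan subalgebra of $C^*(\Lambda)$ in the sense of Renault. -/

import Mathlib

open CategoryTheory Filter Topology
open scoped ENNReal

noncomputable section

/-! ## Higher-rank graphs

A morphism `f : u ⟶ v` of the category is read as a path with range `u` and source `v`, so that
the product of paths, written by juxtaposition in the `k`-graph literature, is `f ≫ g`. -/

namespace KGraph

/-- A degree functor from a small category to the additive monoid `ℕ^k`. -/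
class DegreeFunctor (k : outParam ℕ) (L : Type) [SmallCategory L] where
  degree : ∀ {u v : L}, (u ⟶ v) → (Fin k → ℕ)
  degree_id : ∀ u : L, degree (𝟙 u) = 0
  degree_comp : ∀ {u v w : L} (f : u ⟶ v) (g : v ⟶ w), degree (f ≫ g) = degree f + degree g

/-- The paths (that is, all morphisms) of the category. -/
structure Mor (L : Type) [SmallCategory L] where
  range : L
  source : L
  hom : range ⟶ source

variable {k : ℕ} {L : Type} [SmallCategory L]

/-- The vertex `u`, regarded as a path of degree zero. -/
def Mor.vertex (u : L) : Mor L := ⟨u, u, 𝟙 u⟩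

variable [DegreeFunctor k L]

/-- The degree of a path. -/
def Mor.degree (m : Mor L) : Fin k → ℕ := DegreeFunctor.degree m.hom

variable (L) in
/-- A countable small category with a degree functor is a `k`-graph if it has the unique
factorisation property. -/
structure IsKGraph : Prop where
  countable : Countable (Mor L)
  factorisation : ∀ {u v : L} (f : u ⟶ v) (m n : Fin k → ℕ), DegreeFunctor.degree f = m + n →
    ∃! t : (w : L) × (u ⟶ w) × (w ⟶ v),
      t.2.1 ≫ t.2.2 = f ∧ DegreeFunctor.degree t.2.1 = m ∧ DegreeFunctor.degree t.2.2 = n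

variable (L) in
/-- Every vertex receives only finitely many paths of each degree. -/
def IsRowFinite : Prop :=
  ∀ (u : L) (n : Fin k → ℕ), {m : Mor L | m.range = u ∧ m.degree = n}.Finite

variable (L) in
/-- Every vertex receives at least one path of each degree. -/
def HasNoSources : Prop :=
  ∀ (u : L) (n : Fin k → ℕ), {m : Mor L | m.range = u ∧ m.degree = n}.Nonempty

/-! ## Infinite paths -/

variable (L) in
/-- Infinite paths: degree-preserving functors from the `k`-graph `Ω_k`, whose vertices are the
elements of `ℕ^k` and whose paths are the pairs `(m, n)` with `m ≤ n` (of range `m`, source `n`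
and degree `n - m`). -/
@[ext]
structure InfPath where
  vertex : (Fin k → ℕ) → L
  seg : ∀ m n : Fin k → ℕ, m ≤ n → (vertex m ⟶ vertex n)
  seg_self : ∀ m, seg m m le_rfl = 𝟙 (vertex m)
  seg_comp : ∀ (l m n) (h : l ≤ m) (h' : m ≤ n), seg l m h ≫ seg m n h' = seg l n (h.trans h')
  degree_seg : ∀ (m n) (h : m ≤ n), m + DegreeFunctor.degree (seg m n h) = n

namespace InfPath

/-- The range `x(0)` of an infinite path. -/
def range (x : InfPath L) : L := x.vertex 0

/-- The initial segment `x(0, n)`. -/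
def initial (x : InfPath L) (n : Fin k → ℕ) : Mor L :=
  ⟨x.vertex 0, x.vertex n, x.seg 0 n fun i => Nat.zero_le (n i)⟩

/-- The shift `σ^p(x)(m, n) = x(m + p, n + p)`. -/
def shift (p : Fin k → ℕ) (x : InfPath L) : InfPath L where
  vertex m := x.vertex (m + p)
  seg m n h := x.seg (m + p) (n + p) fun i => Nat.add_le_add_right (h i) (p i)
  seg_self m := x.seg_self (m + p)
  seg_comp l m n _ _ := x.seg_comp (l + p) (m + p) (n + p) _ _
  degree_seg m n h := by
    have := x.degree_seg (m + p) (n + p) fun i => Nat.add_le_add_right (h i) (p i)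
    rw [add_right_comm] at this
    exact add_right_cancel this

theorem shift_shift (p q : Fin k → ℕ) (x : InfPath L) :
    shift q (shift p x) = shift (p + q) x := by
  have key : ∀ m : Fin k → ℕ, m + q + p = m + (p + q) := fun m => by
    rw [add_assoc, add_comm q p]
  have seg_heq : ∀ {a b a' b' : Fin k → ℕ} (h : a ≤ b) (h' : a' ≤ b'), a = a' → b = b' →
      HEq (x.seg a b h) (x.seg a' b' h') := by
    rintro a b _ _ h h' rfl rfl
    rfl
  refine InfPath.ext (funext fun m => congrArg x.vertex (key m)) ?_
  refine Function.hfunext rfl fun m m' hm => ?_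
  cases hm
  refine Function.hfunext rfl fun n n' hn => ?_
  cases hn
  refine Function.hfunext rfl fun h h' _ => ?_
  exact seg_heq _ _ (key m) (key n)

end InfPath

/-- `y = m x`: the infinite path `y` is the concatenation of the path `m` and the infinite
path `x` (whose range is then the source of `m`). -/
def IsConcat (m : Mor L) (x y : InfPath L) : Prop :=
  y.initial m.degree = m ∧ y.shift m.degree = x

/-! ## The infinite-path groupoid -/

/-- The infinite-path groupoid: its units are the infinite paths, and its arrows with range `x`
and source `y` are the triples `(x, n, y)` for which there are `p, q ∈ ℕ^k` with `n = p - q`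
and `σ^p(x) = σ^q(y)`; composition is `(x, m, y) (y, n, z) = (x, m + n, z)`. -/
instance : CategoryTheory.Groupoid (InfPath L) where
  Hom x y := {n : Fin k → ℤ //
    ∃ p q : Fin k → ℕ, x.shift p = y.shift q ∧ ∀ i, n i = (p i : ℤ) - (q i : ℤ)}
  id x := ⟨0, 0, 0, rfl, by simp⟩
  comp {x y z} f g := ⟨f.1 + g.1, by
    obtain ⟨m, p, q, h, hm⟩ := f
    obtain ⟨n, p', q', h', hn⟩ := g
    refine ⟨p + p', q' + q, ?_, fun i => ?_⟩
    · rw [← InfPath.shift_shift, h, InfPath.shift_shift, add_comm q p', ← InfPath.shift_shift, h',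
        InfPath.shift_shift]
    · simp only [Pi.add_apply, hm, hn]; push_cast; ring⟩
  inv {x y} f := ⟨-f.1, by
    obtain ⟨m, p, q, h, hm⟩ := f
    exact ⟨q, p, h.symm, fun i => by simp only [Pi.neg_apply, hm]; ring⟩⟩
  id_comp f := Subtype.ext (zero_add f.1)
  comp_id f := Subtype.ext (add_zero f.1)
  assoc f g h := Subtype.ext (add_assoc f.1 g.1 h.1)
  inv_comp f := Subtype.ext (neg_add_cancel f.1)
  comp_inv f := Subtype.ext (add_neg_cancel f.1)

variable (L) in
/-- The set of all arrows of the infinite-path groupoid. -/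
structure PathGroupoid where
  range : InfPath L
  source : InfPath L
  arrow : range ⟶ source

/-- The basic open set `Z(m, n) = {(m x, d(m) - d(n), n x)}`, for paths `m` and `n` with the
same source. -/
def PathGroupoid.cylinder (m n : Mor L) : Set (PathGroupoid L) :=
  {g | ∃ x : InfPath L, IsConcat m x g.range ∧ IsConcat n x g.source ∧
    ∀ i, g.arrow.1 i = (m.degree i : ℤ) - (n.degree i : ℤ)}

/-- The topology of the infinite-path groupoid. -/
instance : TopologicalSpace (PathGroupoid L) :=
  TopologicalSpace.generateFrom
    {U | ∃ m n : Mor L, m.source = n.source ∧ U = PathGroupoid.cylinder m n}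

variable (L) in
/-- The isotropy of the infinite-path groupoid. -/
def isotropy : Set (PathGroupoid L) := {g | g.range = g.source}

/-! ## The universal algebra of a row-finite `k`-graph without sources -/

/-- Cuntz–Krieger families of a row-finite `k`-graph without sources. -/
structure IsCuntzKrieger {A : Type*} [NonUnitalRing A] [StarRing A] (S : Mor L → A) : Prop where
  isSelfAdjoint : ∀ u : L, star (S (.vertex u)) = S (.vertex u)
  isIdempotent : ∀ u : L, S (.vertex u) * S (.vertex u) = S (.vertex u)
  orthogonal : ∀ u v : L, u ≠ v → S (.vertex u) * S (.vertex v) = 0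
  map_comp : ∀ {u v w : L} (f : u ⟶ v) (g : v ⟶ w), S ⟨u, w, f ≫ g⟩ = S ⟨u, v, f⟩ * S ⟨v, w, g⟩
  star_mul_self : ∀ m : Mor L, star (S m) * S m = S (.vertex m.source)
  sum_eq : ∀ (u : L) (n : Fin k → ℕ) (F : Finset (Mor L)),
    (∀ m, m ∈ F ↔ m.range = u ∧ m.degree = n) → S (.vertex u) = ∑ m ∈ F, S m * star (S m)

variable (L) in
/-- The representations of the Cuntz–Krieger relations on Hilbert spaces. -/
structure CKRep where
  H : Type
  [normed : NormedAddCommGroup H]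
  [inner : InnerProductSpace ℂ H]
  [complete : CompleteSpace H]
  op : Mor L → (H →L[ℂ] H)
  isCuntzKrieger : IsCuntzKrieger op

attribute [instance] CKRep.normed CKRep.inner CKRep.complete

theorem CKRep.norm_op_le_one (R : CKRep L) (m : Mor L) : ‖R.op m‖ ≤ 1 := by
  have hS := R.isCuntzKrieger
  have h1 : ‖R.op (.vertex m.source)‖ * ‖R.op (.vertex m.source)‖ =
      ‖R.op (.vertex m.source)‖ := by
    rw [← CStarRing.norm_star_mul_self, hS.isSelfAdjoint, hS.isIdempotent]
  have h2 : ‖R.op m‖ * ‖R.op m‖ = ‖R.op (.vertex m.source)‖ := by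
    rw [← CStarRing.norm_star_mul_self, hS.star_mul_self]
  have h3 : ‖R.op (.vertex m.source)‖ ≤ 1 := by
    by_contra! h
    nlinarith
  by_contra! h
  nlinarith

variable (L) in
/-- The `C*`-algebra of bounded families of operators, one on the space of each representation of
the Cuntz–Krieger relations, with the supremum norm. -/
def BoundedFamilies : Type 1 := lp (fun R : CKRep L => R.H →L[ℂ] R.H) ∞

instance : NonUnitalCStarAlgebra (BoundedFamilies L) :=
  inferInstanceAs (NonUnitalCStarAlgebra (lp (fun R : CKRep L => R.H →L[ℂ] R.H) ∞))

/-- The direct sum of all Cuntz–Krieger families on Hilbert spaces. -/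
def univFamily (m : Mor L) : BoundedFamilies L :=
  (⟨fun R => R.op m, memℓp_infty ⟨1, by rintro _ ⟨R, rfl⟩; exact R.norm_op_le_one m⟩⟩ :
    lp (fun R : CKRep L => R.H →L[ℂ] R.H) ∞)

variable (L) in
/-- The closed `*`-algebra generated by the direct sum of all Cuntz–Krieger families. -/
def graphAlgebra : NonUnitalStarSubalgebra ℂ (BoundedFamilies L) :=
  (NonUnitalStarAlgebra.adjoin ℂ (Set.range (univFamily (L := L)))).topologicalClosure

instance : IsClosed (graphAlgebra L : Set (BoundedFamilies L)) :=
  NonUnitalStarSubalgebra.isClosed_topologicalClosure _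

variable (L) in
/-- The `C*`-algebra of a row-finite `k`-graph `L` without sources, that is, the universal
`C*`-algebra generated by a Cuntz–Krieger family. -/
def CStar : Type 1 := graphAlgebra L

instance : NonUnitalCStarAlgebra (CStar L) :=
  inferInstanceAs (NonUnitalCStarAlgebra (graphAlgebra L))

/-- The generator `s_m` of the `C*`-algebra of `L`. -/
def gen (m : Mor L) : CStar L :=
  (⟨univFamily m, NonUnitalStarSubalgebra.le_topologicalClosure _
    (NonUnitalStarAlgebra.subset_adjoin ℂ _ ⟨m, rfl⟩)⟩ : graphAlgebra L)

variable (L) in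
/-- The closed linear span of the elements `s_m s_n^*`, where `m` and `n` are paths with the same
source such that `m x = n x` for every infinite path `x` whose range is this source. -/
def cyclineSpan : Submodule ℂ (CStar L) :=
  (Submodule.span ℂ {a | ∃ m n : Mor L, m.source = n.source ∧
    (∀ x : InfPath L, x.range = m.source → ∃ y : InfPath L, IsConcat m x y ∧ IsConcat n x y) ∧
    a = gen m * star (gen n)}).topologicalClosure

end KGraph

/-! ## Subalgebras of `C*`-algebras -/

namespace CStarSub

variable {A : Type*} [NonUnitalCStarAlgebra A]

/-- `B` is maximal among the commutative `C*`-subalgebras of `A`. -/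
def IsMaximalAbelian (B : NonUnitalStarSubalgebra ℂ A) : Prop :=
  Maximal (fun C : NonUnitalStarSubalgebra ℂ A =>
    IsClosed (C : Set A) ∧ ∀ a ∈ C, ∀ b ∈ C, a * b = b * a) B

/-- `P` is a conditional expectation of `A` onto `B`: a positive contractive linear idempotent
with range `B` that is a `B`-bimodule map. -/
structure IsCondExp (B : NonUnitalStarSubalgebra ℂ A) (P : A →ₗ[ℂ] A) : Prop where
  map_mem : ∀ a, P a ∈ B
  map_of_mem : ∀ b ∈ B, P b = b
  norm_le : ∀ a, ‖P a‖ ≤ ‖a‖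
  map_star_mul_self : ∀ a, ∃ c, P (star a * a) = star c * c
  map_mul_left : ∀ b ∈ B, ∀ a, P (b * a) = b * P a
  map_mul_right : ∀ b ∈ B, ∀ a, P (a * b) = P a * b

/-- The normalisers of `B` in `A`. -/
def normalizers (B : NonUnitalStarSubalgebra ℂ A) : Set A :=
  {n | ∀ b ∈ B, star n * b * n ∈ B ∧ n * b * star n ∈ B}

/-- Cartan subalgebras of a `C*`-algebra, in the sense of Renault. -/
structure IsCartan (B : NonUnitalStarSubalgebra ℂ A) : Prop where
  approximateUnit : ∃ l : Filter A, l.IsApproximateUnit ∧ ∀ᶠ a in l, a ∈ B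
  maximalAbelian : IsMaximalAbelian B
  regular : (NonUnitalStarAlgebra.adjoin ℂ (normalizers B)).topologicalClosure = ⊤
  condExp : ∃ P : A →ₗ[ℂ] A, IsCondExp B P ∧ ∀ a, P (star a * a) = 0 → a = 0

end CStarSub

/-! ## The example -/

namespace Example

open KGraph

/-- The three vertices. -/
inductive Vertex
  | u
  | v
  | w

/-- The two colours of edges. -/
inductive Colour
  | blue
  | red

/-- The edges: `Edge x y` consists of the edges with range `x` and source `y`. Each edge of the
list below occurs once in each colour. -/
inductive Edge : Vertex → Vertex → Type
  | e (c : Colour) : Edge .v .v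
  | f (c : Colour) : Edge .u .u
  | g (c : Colour) : Edge .w .w
  | h (c : Colour) : Edge .w .w
  | alpha (c : Colour) : Edge .v .u
  | beta (c : Colour) : Edge .v .w

instance : Quiver Vertex := ⟨Edge⟩

/-- The colour of an edge. -/
def Edge.colour {x y : Vertex} : Edge x y → Colour
  | e c => c
  | f c => c
  | g c => c
  | h c => c
  | alpha c => c
  | beta c => c

/-- Blue edges have degree `(1, 0)` and red edges have degree `(0, 1)`. -/
def Colour.degree : Colour → (Fin 2 → ℕ)
  | .blue => ![1, 0]
  | .red => ![0, 1]

/-- The path `a b` of length two, with `b` following `a`. -/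
def two {x y z : Vertex} (a : Edge x y) (b : Edge y z) : (show Paths Vertex from x) ⟶ z :=
  (Quiver.Hom.toPath (V := Vertex) a).comp (Quiver.Hom.toPath (V := Vertex) b)

open Edge Colour in
/-- The factorisation rules, identifying each blue-red path with a red-blue path. -/
inductive Rule : HomRel (Paths Vertex)
  | ee : Rule (two (e blue) (e red)) (two (e red) (e blue))
  | ealpha : Rule (two (e blue) (alpha red)) (two (e red) (alpha blue))
  | ebeta : Rule (two (e blue) (beta red)) (two (e red) (beta blue))
  | alphaf : Rule (two (alpha blue) (f red)) (two (alpha red) (f blue))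
  | ff : Rule (two (f blue) (f red)) (two (f red) (f blue))
  | betag : Rule (two (beta blue) (g red)) (two (beta red) (g blue))
  | betah : Rule (two (beta blue) (h red)) (two (beta red) (h blue))
  | gg : Rule (two (g blue) (g red)) (two (g red) (g blue))
  | gh : Rule (two (g blue) (h red)) (two (h red) (g blue))
  | hg : Rule (two (h blue) (g red)) (two (g red) (h blue))
  | hh : Rule (two (h blue) (h red)) (two (h red) (h blue))

/-- The category of all paths in the coloured graph, modulo the factorisation rules. -/
abbrev Graph : Type := CategoryTheory.Quotient Rule

/-- The degree of a path in the coloured graph. -/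
def pathDegree {x : Vertex} : ∀ {y : Vertex}, Quiver.Path x y → (Fin 2 → ℕ)
  | _, .nil => 0
  | _, .cons p a => pathDegree p + (Edge.colour a).degree

theorem pathDegree_comp {x y : Vertex} (p : Quiver.Path x y) :
    ∀ {z : Vertex} (q : Quiver.Path y z), pathDegree (p.comp q) = pathDegree p + pathDegree q
  | _, .nil => (add_zero _).symm
  | _, .cons q a => by
    simp only [Quiver.Path.comp_cons, pathDegree, pathDegree_comp p q, add_assoc]

theorem pathDegree_rule {x y : Vertex} {p q : (show Paths Vertex from x) ⟶ y} (h : Rule p q) :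
    pathDegree p = pathDegree q := by
  cases h <;> decide

/-- The degree functor counts the blue and the red edges of a path. -/
instance : DegreeFunctor 2 Graph where
  degree {x y} f := Quot.lift (fun p : Quiver.Path (V := Vertex) x.as y.as => pathDegree p) (by
    rintro _ _ ⟨_, _, p, _, _, q, h⟩
    exact (pathDegree_comp p _).trans ((congrArg _ ((pathDegree_comp _ q).trans
      ((congrArg (· + pathDegree q) (pathDegree_rule h)).trans (pathDegree_comp _ q).symm))).trans
      (pathDegree_comp p _).symm)) f
  degree_id _ := rfl
  degree_comp f g := by
    induction f using Quot.ind
    induction g using Quot.ind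
    exact pathDegree_comp _ _

/-- The path of length one given by an edge. -/
def ofEdge (t : (x : Vertex) × (y : Vertex) × Edge x y) : Mor Graph :=
  ⟨⟨t.1⟩, ⟨t.2.1⟩, (CategoryTheory.Quotient.functor Rule).map
    (X := t.1) (Y := t.2.1) (Quiver.Hom.toPath (V := Vertex) t.2.2)⟩

end Example

end

/-!
The infinite paths that begin with a path `e ⋯ e` from `v` to `v` may leave `v` through `α` or
through `β`, and there they see two different `2`-graphs. Behind `α` a path is determined by its
degree, so a path `e ⋯ e α` acts on infinite paths only through the number of its edges `e`: the
paths `alphaPath m` and `alphaPath n` with `m 0 + m 1 = n 0 + n 1` form a cycline pair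
(`isCycline_alphaPath`). Behind `β` the loops `g` and `h` spell words, and the position of a
letter `h` in such a word records the degree of the path in front of it. Hence paths with source `v`
form a cycline pair only if they are equal (`exists_infPath_not_isConcat`, `eq_of_isCycline`). The
arrow of degree `(1, -1)` at `e e e ⋯` is therefore a limit of interior points of the isotropy,
which pass through `α`, and a limit of arrows outside of the isotropy, which pass through `β`
(`not_isClosed_interior_isotropy`).

The same dichotomy excludes a conditional expectation `P`. Let `a = s_m s_n^*` with `m` the blue and
`n` the red edge `e`, and let `p_j` be the range projection of `alphaPath ![j, j + 1]`. Then `a p_j`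
is a monomial of a cycline pair, so that `P(a) p_j = a p_j`; this has degree `(1, -1)` and norm at
least one. But an element `b` of the span of the cycline monomials satisfies `b p_j = c p_j` for a
scalar `c` and all large `j` (`exists_eventually_mul_proj_eq`). The spectral projection onto degree
zero shows that `a p_j` stays away from all these elements, although they approximate `P(a) p_j`
(`not_exists_isCondExp`).

That the cycline subalgebra is maximal abelian holds for every row-finite `k`-graph with finitely
many vertices, each of which is the range of an infinite path. Cycline monomials commute because
they are diagonal in the representation on the square-summable functions of infinite paths, which is
faithful on the combinations of monomials of one degree. For maximality, let `a` commute with all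
range projections. The gauge action reduces the problem to homogeneous `a`
(`mem_of_spectral_mem`). Approximate such an `a` by a combination of monomials of one bidegree. Its
coefficients at pairs that are not cycline are off-diagonal matrix coefficients in the path
representation, where `a` is diagonal, so they are small. Compressing to the range projections of
all paths of one large degree fixes `a` and leaves at most one of the monomials in each block, so
that the part that is not cycline has small norm (`mem_cyclineSpan_of_homogeneous`).

The factorisation property of the example rests on a complete invariant of paths with given range,
source and degree: the number of edges `e`, together with the word of the other loops, in which blue
letters are written in front and red letters behind (`act`, `hom_ext`). When a path is written with
its last edge of a given colour, this edge can be read off from the invariant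
(`last_edge_unique`).
-/

noncomputable section

namespace KGraph

variable {k : ℕ} {L : Type} [SmallCategory L]

/-! ### Composition and prefixes of paths -/

/-- The composite of two paths, the source of the first of which is only propositionally equal to
the range of the second. -/
def Mor.comp (a b : Mor L) (h : a.source = b.range) : Mor L :=
  ⟨a.range, b.source, a.hom ≫ eqToHom h ≫ b.hom⟩

theorem Mor.comp_congr {a b b' : Mor L} (e : b = b') (h : a.source = b.range) :
    a.comp b h = a.comp b' (e ▸ h) := by
  subst e
  rfl

theorem Mor.comp_mk {u v w : L} (f : u ⟶ v) (g : v ⟶ w) (h) :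
    Mor.comp ⟨u, v, f⟩ ⟨v, w, g⟩ h = ⟨u, w, f ≫ g⟩ := by
  simp [Mor.comp]

theorem Mor.comp_assoc (a b c : Mor L) (h h') :
    (a.comp b h).comp c h' = a.comp (b.comp c h') h := by
  simp [Mor.comp]

@[simp] theorem Mor.comp_vertex (a : Mor L) (u : L) (h) : a.comp (.vertex u) h = a := by
  obtain ⟨_, _, f⟩ := a
  cases h
  exact (Mor.comp_mk _ _ rfl).trans (by simp)

@[simp] theorem Mor.vertex_comp (a : Mor L) (u : L) (h) : (Mor.vertex u).comp a h = a := by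
  obtain ⟨_, _, f⟩ := a
  cases h
  exact (Mor.comp_mk _ _ rfl).trans (by simp)

/-- The path `a` is an initial segment of the path `c`. -/
def Mor.IsPrefix (a c : Mor L) : Prop := ∃ b h, a.comp b h = c

theorem Mor.IsPrefix.trans {a b c : Mor L} : a.IsPrefix b → b.IsPrefix c → a.IsPrefix c := by
  rintro ⟨d, h, rfl⟩ ⟨e, h', rfl⟩
  exact ⟨d.comp e h', h, (Mor.comp_assoc _ _ _ _ _).symm⟩

variable [DegreeFunctor k L]

@[simp] theorem Mor.degree_vertex (u : L) : (Mor.vertex u).degree = 0 :=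
  DegreeFunctor.degree_id u

@[simp] theorem Mor.degree_comp (a b : Mor L) (h) :
    (a.comp b h).degree = a.degree + b.degree := by
  obtain ⟨_, _, f⟩ := a
  obtain ⟨_, _, g⟩ := b
  cases h
  rw [Mor.comp_mk]
  exact DegreeFunctor.degree_comp f g

namespace IsKGraph

variable (hL : IsKGraph L)
include hL

theorem exists_comp_eq (c : Mor L) {m n : Fin k → ℕ} (h : c.degree = m + n) :
    ∃ a b h, Mor.comp a b h = c ∧ a.degree = m ∧ b.degree = n := by
  obtain ⟨⟨w, f, g⟩, ⟨h1, h2, h3⟩, -⟩ := hL.factorisation c.hom m n h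
  exact ⟨⟨_, _, f⟩, ⟨_, _, g⟩, rfl, by rw [Mor.comp_mk]; exact congrArg (Mor.mk _ _) h1, h2, h3⟩

theorem comp_inj {a b a' b' : Mor L} {h h'} (e : a.comp b h = a'.comp b' h')
    (hd : a.degree = a'.degree) : a = a' ∧ b = b' := by
  have hd2 : b.degree = b'.degree := by
    have := congrArg Mor.degree e
    rw [Mor.degree_comp, Mor.degree_comp, hd] at this
    exact add_left_cancel this
  obtain ⟨u, v, f⟩ := a
  obtain ⟨_, w, g⟩ := b
  obtain ⟨u', v', f'⟩ := a'
  obtain ⟨_, w', g'⟩ := b'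
  cases h
  cases h'
  rw [Mor.comp_mk, Mor.comp_mk] at e
  injection e with e1 e2 e3
  subst e1 e2
  have := (hL.factorisation (f ≫ g) _ _ (DegreeFunctor.degree_comp f g)).unique
    (y₁ := ⟨_, f, g⟩) (y₂ := ⟨_, f', g'⟩) ⟨rfl, rfl, rfl⟩ ⟨(eq_of_heq e3).symm, hd.symm, hd2.symm⟩
  cases this
  exact ⟨rfl, rfl⟩

theorem eq_vertex {a : Mor L} (h : a.degree = 0) : a = .vertex a.range :=
  (hL.comp_inj (h := rfl) (h' := rfl) ((Mor.comp_vertex a a.source rfl).trans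
    (Mor.vertex_comp a a.range rfl).symm) (h.trans (Mor.degree_vertex _).symm)).1

theorem exists_prefix {c : Mor L} {n : Fin k → ℕ} (h : n ≤ c.degree) :
    ∃ a : Mor L, a.IsPrefix c ∧ a.degree = n := by
  obtain ⟨a, b, h1, h2, h3, -⟩ := hL.exists_comp_eq c (add_tsub_cancel_of_le h).symm
  exact ⟨a, ⟨b, h1, h2⟩, h3⟩

theorem prefix_unique {a a' c : Mor L} (h : a.IsPrefix c) (h' : a'.IsPrefix c)
    (hd : a.degree = a'.degree) : a = a' := by
  obtain ⟨b, e, h⟩ := h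
  obtain ⟨b', e', h'⟩ := h'
  exact (hL.comp_inj (h.trans h'.symm) hd).1

theorem prefix_of_prefix {a b c : Mor L} (h : a.IsPrefix c) (h' : b.IsPrefix c)
    (hd : a.degree ≤ b.degree) : a.IsPrefix b := by
  obtain ⟨a', h1, h2⟩ := hL.exists_prefix hd
  rwa [hL.prefix_unique h (h1.trans h') h2.symm]

theorem hom_cancel {u v w : L} {f : u ⟶ v} {g g' : v ⟶ w} (h : f ≫ g = f ≫ g') : g = g' := by
  have := (hL.comp_inj (a := ⟨_, _, f⟩) (a' := ⟨_, _, f⟩) (b := ⟨_, _, g⟩) (b' := ⟨_, _, g'⟩)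
    (h := rfl) (h' := rfl) (by rw [Mor.comp_mk, Mor.comp_mk, h]) rfl).2
  injection this

end IsKGraph

/-! ### Infinite paths and their initial segments -/

namespace InfPath

/-- The segment `x(m, n)` as a path. -/
def segMor (x : InfPath L) (m n : Fin k → ℕ) (h : m ≤ n) : Mor L := ⟨_, _, x.seg m n h⟩

theorem segMor_congr (x : InfPath L) {m n m' n' : Fin k → ℕ} (hm : m = m') (hn : n = n') (h h') :
    x.segMor m n h = x.segMor m' n' h' := by
  subst hm hn
  rfl

@[simp] theorem degree_initial (x : InfPath L) (n : Fin k → ℕ) : (x.initial n).degree = n := by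
  have := x.degree_seg 0 n (fun i => Nat.zero_le (n i))
  rwa [zero_add] at this

theorem initial_zero (x : InfPath L) : x.initial 0 = .vertex x.range :=
  congrArg (Mor.mk _ _) (x.seg_self 0)

theorem initial_comp_segMor (x : InfPath L) (m n : Fin k → ℕ) (h : m ≤ n) :
    (x.initial m).comp (x.segMor m n h) rfl = x.initial n :=
  (Mor.comp_mk _ _ _).trans (congrArg (Mor.mk _ _) (x.seg_comp _ _ _ _ _))

theorem initial_isPrefix (x : InfPath L) {m n : Fin k → ℕ} (h : m ≤ n) :
    (x.initial m).IsPrefix (x.initial n) := ⟨_, _, x.initial_comp_segMor m n h⟩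

theorem shift_range (x : InfPath L) (p : Fin k → ℕ) : (x.shift p).range = x.vertex p :=
  congrArg x.vertex (zero_add p)

theorem initial_add (x : InfPath L) (m n : Fin k → ℕ) :
    x.initial (m + n) = (x.initial m).comp ((x.shift m).initial n) (x.shift_range m).symm := by
  have h : (x.shift m).initial n = x.segMor m (m + n) (fun i => Nat.le_add_right (m i) (n i)) :=
    x.segMor_congr (zero_add m) (add_comm n m) (fun i => Nat.add_le_add_right (Nat.zero_le _) _) _
  simp only [h, initial_comp_segMor]

theorem ext_of_segMor {x y : InfPath L} (h : ∀ m n h, x.segMor m n h = y.segMor m n h) :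
    x = y := by
  obtain ⟨v, s, _, _, _⟩ := x
  obtain ⟨v', s', _, _, _⟩ := y
  obtain rfl : v = v' := funext fun m => congrArg Mor.range (h m m le_rfl)
  obtain rfl : s = s' := by
    funext m n e
    have := h m n e
    injection this
  rfl

end InfPath

namespace IsKGraph

variable (hL : IsKGraph L)
include hL

/-- An infinite path is determined by a cofinal family of initial segments. -/
theorem infPath_ext {x y : InfPath L} (h : ∀ n, ∃ N, n ≤ N ∧ x.initial N = y.initial N) :
    x = y := by
  have key (n) : x.initial n = y.initial n := by
    obtain ⟨N, hN, e⟩ := h n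
    exact hL.prefix_unique (x.initial_isPrefix hN) (e ▸ y.initial_isPrefix hN) (by simp)
  refine InfPath.ext_of_segMor fun m n e => ?_
  exact (hL.comp_inj (((x.initial_comp_segMor m n e).trans (key n)).trans
    (y.initial_comp_segMor m n e).symm) (by simp)).2

/-- A coherent family of finite paths, one of each degree, is the family of initial segments of
an infinite path. -/
theorem exists_infPath (φ : (Fin k → ℕ) → Mor L) (hd : ∀ n, (φ n).degree = n)
    (hp : ∀ m n, m ≤ n → (φ m).IsPrefix (φ n)) : ∃ x : InfPath L, ∀ n, x.initial n = φ n := by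
  have h1 (m n : Fin k → ℕ) (h : m ≤ n) : ∃ g : (φ m).source ⟶ (φ n).source,
      φ n = ⟨(φ m).range, (φ n).source, (φ m).hom ≫ g⟩ := by
    obtain ⟨b, e, h⟩ := hp m n h
    rw [← h]
    exact ⟨eqToHom e ≫ b.hom, rfl⟩
  choose g hg using h1
  have h2 {a : Mor L} {r s : L} {f : r ⟶ a.source} (e : a = ⟨r, a.source, f⟩) (c : a.source ⟶ s) :
      (⟨a.range, s, a.hom ≫ c⟩ : Mor L) = ⟨r, s, f ≫ c⟩ := by
    obtain ⟨u, v, f'⟩ := a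
    injection e with e1 _ e2
    subst e1
    rw [eq_of_heq e2]
  have h3 {u v w : L} {f : u ⟶ v} {g g' : v ⟶ w}
      (e : (⟨u, w, f ≫ g⟩ : Mor L) = ⟨u, w, f ≫ g'⟩) : g = g' := by
    injection e with _ _ h
    exact hL.hom_cancel h
  let x : InfPath L :=
    { vertex := fun n => (φ n).source
      seg := g
      seg_self := fun m => h3 ((hg m m le_rfl).symm.trans (by rw [Category.comp_id]))
      seg_comp := fun l m n e e' => by
        refine h3 (Eq.trans ?_ (hg l n (e.trans e')))
        rw [← Category.assoc]
        exact ((hg m n e').trans (h2 (hg l m e) _)).symm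
      degree_seg := fun m n e => by
        have := congrArg Mor.degree (hg m n e)
        conv_rhs => rw [← hd n, this]
        refine Eq.trans ?_ (DegreeFunctor.degree_comp (φ m).hom (g m n e)).symm
        exact congrArg (· + _) (hd m).symm }
  refine ⟨x, fun n => ?_⟩
  have h0 := hL.eq_vertex (hd 0)
  have h4 : (x.initial n).range = (φ 0).range := congrArg Mor.source h0
  have h5 : (φ 0).comp (x.initial n) rfl = φ n := by
    conv_rhs => rw [hg 0 n (fun i => Nat.zero_le (n i))]
    exact Mor.comp_mk _ _ _
  rw [← h5]
  have h6 {a b : Mor L} {u : L} (e : a = .vertex u) (h) : b = a.comp b h := by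
    subst e
    exact (Mor.vertex_comp _ _ _).symm
  exact h6 h0 _

end IsKGraph

/-! ### Concatenation of a path and an infinite path -/

namespace IsConcat

theorem source_eq {m : Mor L} {x y : InfPath L} (h : IsConcat m x y) : m.source = x.range := by
  have h1 : y.vertex m.degree = m.source := congrArg Mor.source h.1
  rw [← h1, ← h.2, InfPath.shift_range]

theorem range_eq {m : Mor L} {x y : InfPath L} (h : IsConcat m x y) : y.range = m.range := by
  rw [← h.1]
  rfl

theorem left_unique {m : Mor L} {x x' y : InfPath L} (h : IsConcat m x y)
    (h' : IsConcat m x' y) : x = x' := h.2.symm.trans h'.2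

theorem initial_add {m : Mor L} {x y : InfPath L} (h : IsConcat m x y) (n : Fin k → ℕ) :
    y.initial (m.degree + n) = m.comp (x.initial n) h.source_eq := by
  have h1 := h.1
  have h2 := h.2
  rw [InfPath.initial_add]
  congr

theorem of_initial {m : Mor L} {y : InfPath L} (h : y.initial m.degree = m) :
    IsConcat m (y.shift m.degree) y := ⟨h, rfl⟩

theorem initial_shift (y : InfPath L) (n : Fin k → ℕ) :
    IsConcat (y.initial n) (y.shift n) y := by
  constructor <;> rw [InfPath.degree_initial]

theorem vertex (y : InfPath L) : IsConcat (.vertex y.range) y y := by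
  have := initial_shift y 0
  rwa [InfPath.initial_zero] at this

theorem comp {a b : Mor L} {x y z : InfPath L} (h : IsConcat b x z) (h' : IsConcat a z y) :
    IsConcat (a.comp b (h'.source_eq.trans h.range_eq)) x y := by
  constructor
  · rw [Mor.degree_comp, h'.initial_add]
    simp only [h.1]
  · rw [Mor.degree_comp, ← InfPath.shift_shift, h'.2, h.2]

end IsConcat

namespace IsKGraph

variable (hL : IsKGraph L)
include hL

theorem concat_unique {m : Mor L} {x y y' : InfPath L} (h : IsConcat m x y)
    (h' : IsConcat m x y') : y = y' :=
  hL.infPath_ext fun n => ⟨m.degree + n, le_add_self, by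
    rw [h.initial_add, h'.initial_add]⟩

/-- A path `m` can be continued by every infinite path `x` with range `s(m)`: the initial segment
of degree `n` of the concatenation is that of `m x(0, n)`. -/
theorem exists_concat {m : Mor L} {x : InfPath L} (h : m.source = x.range) :
    ∃ y, IsConcat m x y := by
  replace h (n : Fin k → ℕ) : m.source = (x.initial n).range := h
  have h1 (n : Fin k → ℕ) : n ≤ (m.comp (x.initial n) (h n)).degree := by simp
  choose φ hφ hφd using fun n => hL.exists_prefix (h1 n)
  have h2 {n n' : Fin k → ℕ} (hn : n ≤ n') :
      (m.comp (x.initial n) (h n)).IsPrefix (m.comp (x.initial n') (h n')) :=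
    ⟨x.segMor n n' hn, rfl, (Mor.comp_assoc _ _ _ (h n) rfl).trans
      (Mor.comp_congr (x.initial_comp_segMor n n' hn) _)⟩
  obtain ⟨y, hy⟩ := hL.exists_infPath φ hφd fun n n' hn => hL.prefix_of_prefix
    ((hφ n).trans (h2 hn)) (hφ n') (by rw [hφd, hφd]; exact hn)
  have h3 : y.initial m.degree = m := by
    rw [hy]
    exact hL.prefix_unique (hφ _) ⟨_, _, rfl⟩ (hφd _)
  refine ⟨y, h3, hL.infPath_ext fun n => ⟨n, le_rfl, ?_⟩⟩
  have h4 : φ (m.degree + n) = m.comp (x.initial n) (h n) :=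
    hL.prefix_unique (hφ _) (h2 le_add_self) (by simp [hφd])
  rw [← hy, (IsConcat.of_initial h3).initial_add] at h4
  exact (hL.comp_inj h4 rfl).2

theorem concat_comp_iff {a b : Mor L} {h : a.source = b.range} {x y : InfPath L} :
    IsConcat (a.comp b h) x y ↔ ∃ z, IsConcat b x z ∧ IsConcat a z y := by
  refine ⟨fun H => ?_, fun ⟨z, h1, h2⟩ => h1.comp h2⟩
  obtain ⟨z, hz⟩ := hL.exists_concat (m := b) (x := x) H.source_eq
  obtain ⟨y', hy'⟩ := hL.exists_concat (m := a) (x := z) (h.trans hz.range_eq.symm)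
  rw [hL.concat_unique H (hz.comp hy')]
  exact ⟨z, hz, hy'⟩

end IsKGraph

/-- Paths `m` and `n` with the same source form a cycline pair if `m x = n x` for every infinite
path `x` with this range. -/
def IsCycline (m n : Mor L) : Prop :=
  m.source = n.source ∧
    ∀ x : InfPath L, x.range = m.source → ∃ y : InfPath L, IsConcat m x y ∧ IsConcat n x y

theorem IsCycline.symm {m n : Mor L} (h : IsCycline m n) : IsCycline n m :=
  ⟨h.1.symm, fun x hx => (h.2 x (hx.trans h.1.symm)).imp fun _ => And.symm⟩

theorem IsKGraph.isCycline_refl (hL : IsKGraph L) (m : Mor L) : IsCycline m m :=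
  ⟨rfl, fun _ hx => (hL.exists_concat hx.symm).imp fun _ h => ⟨h, h⟩⟩

/-- If `n p = m' q` for cycline pairs `(m, n)` and `(m', n')`, then `(m p, n' q)` is a cycline
pair. -/
theorem IsKGraph.isCycline_comp (hL : IsKGraph L) {m n m' n' p q : Mor L} (h : IsCycline m n)
    (h' : IsCycline m' n') {h1 h2 h3 h4} (e : n.comp p h1 = m'.comp q h2) :
    IsCycline (m.comp p h3) (n'.comp q h4) := by
  have hs : p.source = q.source := (congrArg Mor.source e :)
  refine ⟨hs, fun x hx => ?_⟩
  obtain ⟨z, hz⟩ := hL.exists_concat (m := p) (x := x) hx.symm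
  obtain ⟨y, hy, hy'⟩ := h.2 z (hz.range_eq.trans h3.symm)
  have : IsConcat (m'.comp q h2) x y := e ▸ hz.comp hy'
  obtain ⟨z', hz', hy2⟩ := hL.concat_comp_iff.1 this
  obtain ⟨y2, hy3, hy4⟩ := h'.2 z' hy2.source_eq.symm
  obtain rfl := hL.concat_unique hy2 hy3
  exact ⟨y, hz.comp hy, hz'.comp hy4⟩

end KGraph

namespace KGraph

variable {k : ℕ} {L : Type} [SmallCategory L] [DegreeFunctor k L]

/-! ### The representations of the universal algebra -/

/-- The representation of the universal algebra given by a Cuntz–Krieger family of operators. -/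
def CKRep.rep (R : CKRep L) : CStar L →⋆ₙₐ[ℂ] (R.H →L[ℂ] R.H) where
  toFun a := (a : graphAlgebra L).1.1 R
  map_smul' _ _ := rfl
  map_zero' := rfl
  map_add' _ _ := rfl
  map_mul' _ _ := rfl
  map_star' _ := rfl

theorem CKRep.norm_rep_le (R : CKRep L) (a : CStar L) : ‖R.rep a‖ ≤ ‖a‖ :=
  lp.norm_apply_le_norm ENNReal.top_ne_zero ((a : graphAlgebra L).1 : lp _ ∞) R

theorem norm_le_of_rep {a : CStar L} {C : ℝ} (hC : 0 ≤ C) (h : ∀ R : CKRep L, ‖R.rep a‖ ≤ C) :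
    ‖a‖ ≤ C :=
  lp.norm_le_of_forall_le (f := ((a : graphAlgebra L).1 : lp _ ∞)) hC h

theorem CStar.ext_rep {a b : CStar L} (h : ∀ R : CKRep L, R.rep a = R.rep b) : a = b :=
  Subtype.ext (lp.ext (funext h))

theorem isCuntzKrieger_gen : IsCuntzKrieger (gen (L := L)) where
  isSelfAdjoint u := CStar.ext_rep fun R => by
    rw [map_star]; exact R.isCuntzKrieger.isSelfAdjoint u
  isIdempotent u := CStar.ext_rep fun R => by
    rw [map_mul]; exact R.isCuntzKrieger.isIdempotent u
  orthogonal u v h := CStar.ext_rep fun R => by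
    rw [map_mul, map_zero]; exact R.isCuntzKrieger.orthogonal u v h
  map_comp f g := CStar.ext_rep fun R => by
    rw [map_mul]; exact R.isCuntzKrieger.map_comp f g
  star_mul_self m := CStar.ext_rep fun R => by
    rw [map_mul, map_star]; exact R.isCuntzKrieger.star_mul_self m
  sum_eq u n F h := CStar.ext_rep fun R => by
    simp only [map_sum, map_mul, map_star]; exact R.isCuntzKrieger.sum_eq u n F h

/-! ### Relations between the generators -/

theorem gen_comp (a b : Mor L) (h : a.source = b.range) :
    gen (a.comp b h) = gen a * gen b := by
  obtain ⟨_, _, f⟩ := a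
  obtain ⟨_, _, g⟩ := b
  cases h
  rw [Mor.comp_mk]
  exact isCuntzKrieger_gen.map_comp f g

theorem gen_vertex_mul (m : Mor L) : gen (.vertex m.range) * gen m = gen m :=
  (gen_comp (.vertex m.range) m rfl).symm.trans (congrArg gen (Mor.vertex_comp m _ rfl))

theorem gen_mul_vertex (m : Mor L) : gen m * gen (.vertex m.source) = gen m :=
  (gen_comp m (.vertex m.source) rfl).symm.trans (congrArg gen (Mor.comp_vertex m _ rfl))

theorem star_gen_mul_self (m : Mor L) : star (gen m) * gen m = gen (.vertex m.source) :=
  isCuntzKrieger_gen.star_mul_self m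

theorem star_gen_vertex (u : L) : star (gen (.vertex u)) = gen (.vertex u : Mor L) :=
  isCuntzKrieger_gen.isSelfAdjoint u

theorem star_gen_mul_gen_comp (a b : Mor L) (h : a.source = b.range) :
    star (gen a) * gen (a.comp b h) = gen b := by
  rw [gen_comp, ← mul_assoc, star_gen_mul_self, h, gen_vertex_mul]

theorem star_gen_mul_gen_of_range_ne {m n : Mor L} (h : m.range ≠ n.range) :
    star (gen m) * gen n = 0 := by
  rw [← gen_vertex_mul m, ← gen_vertex_mul n, star_mul, star_gen_vertex, mul_assoc,
    ← mul_assoc (gen (.vertex _)), isCuntzKrieger_gen.orthogonal _ _ h, zero_mul, mul_zero]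

/-- The finite set of the paths of degree `n` with range `u`. -/
def IsRowFinite.paths (hF : IsRowFinite L) (u : L) (n : Fin k → ℕ) : Finset (Mor L) :=
  (hF u n).toFinset

theorem IsRowFinite.mem_paths (hF : IsRowFinite L) {u : L} {n : Fin k → ℕ} (m : Mor L) :
    m ∈ hF.paths u n ↔ m.range = u ∧ m.degree = n :=
  (hF u n).mem_toFinset

theorem gen_vertex_eq_sum (hF : IsRowFinite L) (u : L) (n : Fin k → ℕ) :
    gen (.vertex u) = ∑ m ∈ hF.paths u n, gen m * star (gen m) :=
  isCuntzKrieger_gen.sum_eq u n _ hF.mem_paths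

/-- The ranges of the generators of the same degree are orthogonal, because the sum of their range
projections is a projection. -/
theorem star_gen_mul_gen_of_ne (hF : IsRowFinite L) {m n : Mor L} (hd : m.degree = n.degree)
    (h : m ≠ n) : star (gen m) * gen n = 0 := by
  by_cases hr : m.range = n.range
  swap
  · exact star_gen_mul_gen_of_range_ne hr
  refine CStar.ext_rep fun R => ?_
  ext η
  -- A vector `ξ` in the range of `S_n` exhausts the sum of the `‖S_i^* ξ‖²`, so `S_m^* ξ = 0`.
  set ξ := R.op n η
  have hsum : ∀ ζ : R.H, RCLike.re (inner ℂ ζ (R.op (.vertex n.range) ζ)) =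
      ∑ m ∈ hF.paths n.range n.degree, ‖star (R.op m) ζ‖ ^ 2 := by
    intro ζ
    rw [R.isCuntzKrieger.sum_eq n.range n.degree _ hF.mem_paths]
    simp only [sum_apply, inner_sum, map_sum, mul_apply_eq_comp]
    refine Finset.sum_congr rfl fun i _ => ?_
    rw [← ContinuousLinearMap.adjoint_inner_left, ContinuousLinearMap.star_eq_adjoint,
      inner_self_eq_norm_sq]
  have h1 : R.op (.vertex n.range) ξ = ξ := by
    have := congrArg R.rep (gen_vertex_mul n)
    rw [map_mul] at this
    exact congrArg (· η) this
  have h2 : ‖star (R.op n) ξ‖ ^ 2 = ‖ξ‖ ^ 2 := by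
    have h3 : R.op n (star (R.op n) ξ) = ξ := by
      have := congrArg R.rep (gen_mul_vertex n)
      rw [← star_gen_mul_self, ← mul_assoc, map_mul, map_mul, map_star] at this
      exact congrArg (· η) this
    rw [← inner_self_eq_norm_sq (𝕜 := ℂ), ContinuousLinearMap.star_eq_adjoint,
      ContinuousLinearMap.adjoint_inner_left, ← ContinuousLinearMap.star_eq_adjoint, h3,
      inner_self_eq_norm_sq]
  have h4 := hsum ξ
  rw [h1, inner_self_eq_norm_sq] at h4
  have h5 : ‖star (R.op n) ξ‖ ^ 2 + ‖star (R.op m) ξ‖ ^ 2 ≤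
      ∑ m ∈ hF.paths n.range n.degree, ‖star (R.op m) ξ‖ ^ 2 := by
    classical
    rw [← Finset.sum_pair (f := fun m => ‖star (R.op m) ξ‖ ^ 2) h.symm]
    refine Finset.sum_le_sum_of_subset_of_nonneg ?_ fun _ _ _ => by positivity
    intro i hi
    rw [hF.mem_paths]
    rcases Finset.mem_insert.1 hi with rfl | hi
    · exact ⟨rfl, rfl⟩
    · obtain rfl := Finset.mem_singleton.1 hi
      exact ⟨hr, hd⟩
  have h6 : ‖star (R.op m) ξ‖ ^ 2 = 0 := le_antisymm (by linarith) (by positivity)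
  rw [map_mul, map_star, map_zero]
  exact norm_eq_zero.1 (pow_eq_zero_iff two_ne_zero |>.1 h6)

section

variable (hL : IsKGraph L) (hF : IsRowFinite L)
include hL hF

theorem star_gen_mul_gen_of_not_isPrefix {a c : Mor L} (hd : a.degree ≤ c.degree)
    (h : ¬ a.IsPrefix c) : star (gen a) * gen c = 0 := by
  obtain ⟨a', ⟨b, e, rfl⟩, h2⟩ := hL.exists_prefix hd
  have : a ≠ a' := by
    rintro rfl
    exact h ⟨b, e, rfl⟩
  rw [gen_comp, ← mul_assoc, star_gen_mul_gen_of_ne hF h2.symm this, zero_mul]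

/-- The product of two monomials `s_a s_b^*` and `s_c s_d^*` is a sum of monomials
`s_{a p} s_{d q}^*` with `b p = c q`. -/
theorem monomial_mul_mem {a b c d : Mor L} (hab : a.source = b.source) (hcd : c.source = d.source)
    {S : Submodule ℂ (CStar L)}
    (hS : ∀ (p q : Mor L) (h1 : b.source = p.range) (h2 : c.source = q.range),
      b.comp p h1 = c.comp q h2 →
      gen (a.comp p (hab.trans h1)) * star (gen (d.comp q (hcd.symm.trans h2))) ∈ S) :
    gen a * star (gen b) * (gen c * star (gen d)) ∈ S := by
  by_cases hr : b.range = c.range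
  swap
  · rw [mul_assoc, ← mul_assoc (star (gen b)), star_gen_mul_gen_of_range_ne hr, zero_mul, mul_zero]
    exact S.zero_mem
  -- Both `b` and `c` are comparable with the paths of degree `d(b) + d(c)`.
  have h1 : gen a * star (gen b) * (gen c * star (gen d)) =
      ∑ m ∈ hF.paths c.range (b.degree + c.degree),
        gen a * (star (gen b) * gen m) * (star (gen m) * gen c) * star (gen d) := by
    conv_lhs => rw [← gen_vertex_mul c, gen_vertex_eq_sum hF _ (b.degree + c.degree)]
    simp only [Finset.sum_mul, Finset.mul_sum, mul_assoc]
  rw [h1]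
  refine Submodule.sum_mem _ fun m hm => ?_
  obtain ⟨-, hd⟩ := (hF.mem_paths m).1 hm
  by_cases hb : b.IsPrefix m
  swap
  · rw [star_gen_mul_gen_of_not_isPrefix hL hF (by rw [hd]; exact le_self_add) hb]
    simp
  by_cases hc : c.IsPrefix m
  swap
  · have := star_gen_mul_gen_of_not_isPrefix hL hF (by rw [hd]; exact le_add_self) hc
    rw [← star_star (gen c), ← star_mul, this]
    simp
  obtain ⟨p, h1, rfl⟩ := hb
  obtain ⟨q, h2, h3⟩ := hc
  have h4 : star (gen (b.comp p h1)) * gen c = star (gen q) := by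
    rw [← star_star (gen c), ← star_mul, ← h3, star_gen_mul_gen_comp]
  rw [star_gen_mul_gen_comp, h4, mul_assoc (gen a * gen p), ← star_mul,
    ← gen_comp _ _ (hab.trans h1), ← gen_comp _ _ (hcd.symm.trans h2)]
  exact hS p q h1 h2 h3.symm

end

/-! ### Algebras spanned by monomials -/

/-- A relation between paths with the same source for which the monomials `s_m s_n^*` with
`T m n` span a `*`-algebra. -/
structure IsPairRel (T : Mor L → Mor L → Prop) : Prop where
  symm : ∀ {m n}, T m n → T n m
  source_eq : ∀ {m n}, T m n → m.source = n.source
  comp : ∀ {m n m' n' p q : Mor L}, T m n → T m' n' → ∀ {h1 h2 h3 h4},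
    n.comp p h1 = m'.comp q h2 → T (m.comp p h3) (n'.comp q h4)

/-- The linear span of the monomials `s_m s_n^*` with `T m n`. -/
def pairSpan (T : Mor L → Mor L → Prop) : Submodule ℂ (CStar L) :=
  Submodule.span ℂ {a | ∃ m n : Mor L, T m n ∧ a = gen m * star (gen n)}

theorem mem_pairSpan {T : Mor L → Mor L → Prop} {m n : Mor L} (h : T m n) :
    gen m * star (gen n) ∈ pairSpan T := Submodule.subset_span ⟨m, n, h, rfl⟩

/-- The linear span of the monomials `s_m s_n^*` with `T m n`, as a `*`-algebra. -/
def pairAlgebra (hL : IsKGraph L) (hF : IsRowFinite L) {T : Mor L → Mor L → Prop}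
    (hT : IsPairRel T) : NonUnitalStarSubalgebra ℂ (CStar L) where
  carrier := pairSpan T
  add_mem' := (pairSpan T).add_mem
  zero_mem' := (pairSpan T).zero_mem
  smul_mem' c _ h := (pairSpan T).smul_mem c h
  mul_mem' {x y} hx hy := by
    refine Submodule.span_induction (p := fun x _ => x * y ∈ pairSpan T) ?_ ?_ ?_ ?_ hx
    · rintro _ ⟨a, b, hab, rfl⟩
      refine Submodule.span_induction (p := fun y _ => _ * y ∈ pairSpan T) ?_ ?_ ?_ ?_ hy
      · rintro _ ⟨c, d, hcd, rfl⟩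
        exact monomial_mul_mem hL hF (hT.source_eq hab) (hT.source_eq hcd)
          fun p q h1 h2 e => mem_pairSpan (hT.comp hab hcd e)
      · rw [mul_zero]; exact Submodule.zero_mem _
      · intro y z _ _ h h'; rw [mul_add]; exact Submodule.add_mem _ h h'
      · intro c y _ h; rw [mul_smul_comm]; exact Submodule.smul_mem _ _ h
    · rw [zero_mul]; exact Submodule.zero_mem _
    · intro y z _ _ h h'; rw [add_mul]; exact Submodule.add_mem _ h h'
    · intro c y _ h; rw [smul_mul_assoc]; exact Submodule.smul_mem _ _ h
  star_mem' {x} hx := by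
    refine Submodule.span_induction (p := fun x _ => star x ∈ pairSpan T) ?_ ?_ ?_ ?_ hx
    · rintro _ ⟨a, b, hab, rfl⟩
      rw [star_mul, star_star]
      exact mem_pairSpan (hT.symm hab)
    · rw [star_zero]; exact Submodule.zero_mem _
    · intro y z _ _ h h'; rw [star_add]; exact Submodule.add_mem _ h h'
    · intro c y _ h; rw [star_smul]; exact Submodule.smul_mem _ _ h

theorem isPairRel_source : IsPairRel fun m n : Mor L => m.source = n.source where
  symm h := h.symm
  source_eq h := h
  comp _ _ _ _ _ _ e := (congrArg Mor.source e :)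

theorem isPairRel_isCycline (hL : IsKGraph L) : IsPairRel (IsCycline (L := L)) where
  symm h := h.symm
  source_eq h := h.1
  comp h h' _ _ _ _ e := hL.isCycline_comp h h' e

/-- The monomials `s_m s_n^*` span a dense subspace. -/
theorem dense_pairSpan (hL : IsKGraph L) (hF : IsRowFinite L) :
    (pairSpan fun m n : Mor L => m.source = n.source).topologicalClosure = ⊤ := by
  let ι : CStar L →⋆ₙₐ[ℂ] BoundedFamilies L := NonUnitalStarSubalgebraClass.subtype (graphAlgebra L)
  have h1 : NonUnitalStarAlgebra.adjoin ℂ (Set.range (univFamily (L := L))) ≤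
      (pairAlgebra hL hF isPairRel_source).map ι := by
    refine NonUnitalStarAlgebra.adjoin_le ?_
    rintro _ ⟨m, rfl⟩
    refine ⟨gen m, ?_, rfl⟩
    have : gen m * star (gen (.vertex m.source)) ∈
        pairSpan fun m n : Mor L => m.source = n.source := mem_pairSpan rfl
    rwa [star_gen_vertex, gen_mul_vertex] at this
  refine eq_top_iff.2 fun a _ => ?_
  refine Metric.mem_closure_iff.2 fun ε hε => ?_
  have h2 : ι a ∈ closure (NonUnitalStarAlgebra.adjoin ℂ (Set.range (univFamily (L := L))) :
    Set (BoundedFamilies L)) := (a : graphAlgebra L).2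
  obtain ⟨b, hb, hab⟩ := Metric.mem_closure_iff.1 h2 ε hε
  obtain ⟨c, hc, rfl⟩ := h1 hb
  exact ⟨c, hc, hab⟩

end KGraph

namespace KGraph

variable {k : ℕ} {L : Type} [SmallCategory L] [DegreeFunctor k L]

open UnitAddTorus MeasureTheory

/-! ### The gauge action -/

/-- The degree of a path as an element of `ℤ^k`. -/
def Mor.intDegree (m : Mor L) : Fin k → ℤ := fun i => m.degree i

theorem Mor.intDegree_comp (a b : Mor L) (h) :
    (a.comp b h).intDegree = a.intDegree + b.intDegree := by
  funext i
  simp [Mor.intDegree]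

theorem mFourier_star_mul_self (n : Fin k → ℤ) (t : UnitAddTorus (Fin k)) :
    star (mFourier n t) * mFourier n t = 1 := by
  have : mFourier (-n + n) t = star (mFourier n t) * mFourier n t := by
    rw [mFourier_add, mFourier_neg]; rfl
  rw [← this, neg_add_cancel, mFourier_zero]
  rfl

/-- The Cuntz–Krieger family `t^{d(m)} S_m`, for a point `t` of the torus. -/
def CKRep.twist (R : CKRep L) (t : UnitAddTorus (Fin k)) : CKRep L where
  H := R.H
  op m := mFourier m.intDegree t • R.op m
  isCuntzKrieger := by
    have hR := R.isCuntzKrieger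
    have h0 (u : L) : mFourier (Mor.vertex u : Mor L).intDegree t = 1 := by
      have : (Mor.vertex u : Mor L).intDegree = 0 := by
        funext i
        simp [Mor.intDegree]
      rw [this, mFourier_zero]
      rfl
    have h1 (m : Mor L) := mFourier_star_mul_self m.intDegree t
    refine ⟨fun u => ?_, fun u => ?_, fun u v h => ?_, fun {u v w} f g => ?_, fun m => ?_,
      fun u n F hF => ?_⟩
    · rw [h0, one_smul, hR.isSelfAdjoint]
    · rw [h0, one_smul, hR.isIdempotent]
    · rw [h0, h0, one_smul, one_smul, hR.orthogonal u v h]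
    · rw [smul_mul_smul_comm, ← hR.map_comp, ← mFourier_add, ← Mor.intDegree_comp _ _ rfl]
      rw [Mor.comp_mk]
    · rw [star_smul, smul_mul_smul_comm, h1, h0, one_smul, one_smul, hR.star_mul_self]
    · rw [h0, one_smul, hR.sum_eq u n F hF]
      refine Finset.sum_congr rfl fun m _ => ?_
      rw [star_smul, smul_mul_smul_comm, mul_comm, h1, one_smul]

/-- The gauge action on the bounded families of operators. -/
def gaugeFamilies (t : UnitAddTorus (Fin k)) : BoundedFamilies L →⋆ₙₐ[ℂ] BoundedFamilies L where
  toFun b := (⟨fun R => b.1 (R.twist t), memℓp_infty (by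
    obtain ⟨C, hC⟩ := (memℓp_infty_iff.1 b.2)
    refine ⟨C, ?_⟩
    rintro _ ⟨R, rfl⟩
    exact hC ⟨R.twist t, rfl⟩)⟩ : lp (fun R : CKRep L => R.H →L[ℂ] R.H) ∞)
  map_smul' _ _ := rfl
  map_zero' := rfl
  map_add' _ _ := rfl
  map_mul' _ _ := rfl
  map_star' _ := rfl

theorem gaugeFamilies_univFamily (t : UnitAddTorus (Fin k)) (m : Mor L) :
    gaugeFamilies t (univFamily m) = mFourier m.intDegree t • univFamily m := rfl

theorem norm_gaugeFamilies_le (t : UnitAddTorus (Fin k)) (b : BoundedFamilies L) :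
    ‖gaugeFamilies t b‖ ≤ ‖b‖ :=
  lp.norm_le_of_forall_le (f := (gaugeFamilies t b : lp _ ∞)) (norm_nonneg _) fun R =>
    lp.norm_apply_le_norm ENNReal.top_ne_zero (b : lp _ ∞) (R.twist t)

theorem gaugeFamilies_mem (t : UnitAddTorus (Fin k)) {b : BoundedFamilies L}
    (hb : b ∈ graphAlgebra L) : gaugeFamilies t b ∈ graphAlgebra L := by
  have h1 : NonUnitalStarAlgebra.adjoin ℂ (Set.range (univFamily (L := L))) ≤
      (graphAlgebra L).comap (gaugeFamilies t) := by
    refine NonUnitalStarAlgebra.adjoin_le ?_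
    rintro _ ⟨m, rfl⟩
    change gaugeFamilies t (univFamily m) ∈ graphAlgebra L
    rw [gaugeFamilies_univFamily]
    exact (mFourier m.intDegree t • (gen m : graphAlgebra L)).2
  have h2 : Continuous (gaugeFamilies (L := L) t) :=
    AddMonoidHomClass.continuous_of_bound _ 1 fun b => by
      rw [one_mul]; exact norm_gaugeFamilies_le t b
  have h3 : IsClosed (graphAlgebra L : Set (BoundedFamilies L)) := inferInstance
  exact closure_minimal (t := gaugeFamilies t ⁻¹' (graphAlgebra L)) h1 (h3.preimage h2) hb

/-- The gauge action of the torus on the algebra of `L`, under which `s_m` is homogeneous of degree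
`d(m)`. -/
def gauge (t : UnitAddTorus (Fin k)) : CStar L →⋆ₙₐ[ℂ] CStar L where
  toFun a := (⟨gaugeFamilies t (a : graphAlgebra L).1, gaugeFamilies_mem t (a : graphAlgebra L).2⟩ :
    graphAlgebra L)
  map_smul' _ _ := rfl
  map_zero' := rfl
  map_add' _ _ := rfl
  map_mul' _ _ := rfl
  map_star' _ := rfl

theorem gauge_gen (t : UnitAddTorus (Fin k)) (m : Mor L) :
    gauge t (gen m) = mFourier m.intDegree t • gen m := rfl

theorem norm_gauge_le (t : UnitAddTorus (Fin k)) (a : CStar L) : ‖gauge t a‖ ≤ ‖a‖ :=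
  norm_gaugeFamilies_le t _

theorem gauge_monomial (t : UnitAddTorus (Fin k)) (m n : Mor L) :
    gauge t (gen m * star (gen n)) =
      mFourier (m.intDegree - n.intDegree) t • (gen m * star (gen n)) := by
  rw [map_mul, map_star, gauge_gen, gauge_gen, star_smul, smul_mul_smul_comm, sub_eq_add_neg,
    mFourier_add, mFourier_neg]
  rfl

theorem continuous_gauge (hL : IsKGraph L) (hF : IsRowFinite L) (a : CStar L) :
    Continuous fun t => gauge t a := by
  have h0 : ∀ b ∈ pairSpan fun m n : Mor L => m.source = n.source,
      Continuous fun t => gauge t b := by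
    intro b hb
    refine Submodule.span_induction (p := fun b _ => Continuous fun t => gauge t b) ?_ ?_ ?_ ?_ hb
    · rintro _ ⟨m, n, -, rfl⟩
      simp only [gauge_monomial]
      fun_prop
    · simp only [map_zero]
      exact continuous_const
    · intro x y _ _ hx hy
      simp only [map_add]
      exact hx.add hy
    · intro c x _ hx
      simp only [map_smul]
      exact hx.const_smul c
  have ha : a ∈ (pairSpan fun m n : Mor L => m.source = n.source).topologicalClosure := by
    rw [dense_pairSpan hL hF]; trivial
  refine continuous_of_uniform_approx_of_continuous fun u hu => ?_
  obtain ⟨ε, hε, hu⟩ := Metric.mem_uniformity_dist.1 hu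
  obtain ⟨b, hb, hab⟩ := Metric.mem_closure_iff.1 ha ε hε
  refine ⟨_, h0 b hb, fun t => hu ?_⟩
  rw [dist_eq_norm, ← map_sub]
  exact (norm_gauge_le t _).trans_lt (by rwa [← dist_eq_norm])

theorem gauge_zero (hL : IsKGraph L) (hF : IsRowFinite L) (a : CStar L) : gauge 0 a = a := by
  have ha : a ∈ (pairSpan fun m n : Mor L => m.source = n.source).topologicalClosure := by
    rw [dense_pairSpan hL hF]; trivial
  have h1 : Continuous (gauge (L := L) 0) :=
    AddMonoidHomClass.continuous_of_bound _ 1 fun b => by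
      rw [one_mul]; exact norm_gauge_le 0 b
  refine closure_minimal (t := {a | gauge 0 a = a}) (fun b hb => ?_)
    (isClosed_eq h1 continuous_id) ha
  refine Submodule.span_induction (p := fun b _ => gauge 0 b = b) ?_ (map_zero _) ?_ ?_ hb
  · rintro _ ⟨m, n, -, rfl⟩
    have h2 (i : Fin k → ℤ) : mFourier i (0 : UnitAddTorus (Fin k)) = 1 := by
      simp [mFourier]
    rw [gauge_monomial, h2, one_smul]
  · intro x y _ _ hx hy
    rw [map_add, hx, hy]
  · intro c x _ hx
    rw [map_smul, hx]

/-! ### Spectral projections -/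

section

-- Fourier coefficients on the torus are taken with respect to the probability Haar measure.
local instance : MeasureSpace UnitAddCircle := ⟨AddCircle.haarAddCircle⟩

local instance : Measure.IsAddHaarMeasure (volume : Measure UnitAddCircle) :=
  inferInstanceAs (Measure.IsAddHaarMeasure AddCircle.haarAddCircle)

local instance : IsProbabilityMeasure (volume : Measure UnitAddCircle) :=
  inferInstanceAs (IsProbabilityMeasure AddCircle.haarAddCircle)

variable {E : Type*} [NormedAddCommGroup E] [NormedSpace ℂ E]

theorem integrable_mFourier_smul {f : UnitAddTorus (Fin k) → E} (hf : Continuous f)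
    (n : Fin k → ℤ) : Integrable fun t => mFourier (-n) t • f t :=
  Continuous.integrable_of_hasCompactSupport (by fun_prop) (HasCompactSupport.of_compactSpace _)

theorem mFourierCoeff_add {f g : UnitAddTorus (Fin k) → E} (hf : Continuous f) (hg : Continuous g)
    (n : Fin k → ℤ) :
    mFourierCoeff (fun t => f t + g t) n = mFourierCoeff f n + mFourierCoeff g n := by
  simp only [mFourierCoeff, smul_add]
  exact integral_add (integrable_mFourier_smul hf n) (integrable_mFourier_smul hg n)

theorem mFourierCoeff_smul (c : ℂ) (f : UnitAddTorus (Fin k) → E) (n : Fin k → ℤ) :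
    mFourierCoeff (fun t => c • f t) n = c • mFourierCoeff f n := by
  simp only [mFourierCoeff, smul_comm _ c]
  exact integral_smul _ _

theorem norm_mFourierCoeff_le {f : UnitAddTorus (Fin k) → E} {C : ℝ} (h : ∀ t, ‖f t‖ ≤ C)
    (n : Fin k → ℤ) : ‖mFourierCoeff f n‖ ≤ C := by
  have h1 (t : UnitAddTorus (Fin k)) : ‖mFourier (-n) t • f t‖ ≤ C := by
    have h2 : ‖mFourier (-n) t‖ ≤ 1 := ((mFourier (-n)).norm_coe_le_norm t).trans mFourier_norm.le
    rw [norm_smul]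
    exact (mul_le_of_le_one_left (norm_nonneg _) h2).trans (h t)
  have := norm_integral_le_of_norm_le_const (μ := (volume : Measure (UnitAddTorus (Fin k))))
    (Eventually.of_forall h1)
  simpa [mFourierCoeff] using this

theorem map_mFourierCoeff [CompleteSpace E] {F : Type*} [NormedAddCommGroup F] [NormedSpace ℂ F]
    [CompleteSpace F] (T : E →L[ℂ] F) {f : UnitAddTorus (Fin k) → E} (hf : Continuous f)
    (n : Fin k → ℤ) : T (mFourierCoeff f n) = mFourierCoeff (fun t => T (f t)) n := by
  simp only [mFourierCoeff, ← map_smul]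
  exact (T.integral_comp_comm (integrable_mFourier_smul hf n)).symm

theorem mFourierCoeff_mFourier_smul [CompleteSpace E] (m n : Fin k → ℤ) (c : E) :
    mFourierCoeff (fun t => mFourier m t • c) n = if m = n then c else 0 := by
  have h := (orthonormal_iff_ite.1 (orthonormal_mFourier (d := Fin k))) n m
  simp only [ContinuousMap.inner_toLp, ← mFourier_neg] at h
  simp only [mFourierCoeff, smul_smul, mul_comm (mFourier (-n) _)]
  rw [integral_smul_const, h]
  simp only [eq_comm, ite_smul, one_smul, zero_smul]

/-- A continuous function on the torus with values in a Banach space takes its values in every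
closed subspace that contains its Fourier coefficients. -/
theorem mem_of_mFourierCoeff_mem [CompleteSpace E] {f : UnitAddTorus (Fin k) → E}
    (hf : Continuous f) {V : Submodule ℂ E} (hV : IsClosed (V : Set E))
    (h : ∀ n, mFourierCoeff f n ∈ V) (t : UnitAddTorus (Fin k)) : f t ∈ V := by
  by_contra ht
  -- For a functional `φ` that separates `f t` from `V`, all Fourier coefficients of `φ ∘ f` vanish.
  obtain ⟨φ, hφ, hφV⟩ : ∃ φ : StrongDual ℂ E, φ (f t) ≠ 0 ∧ ∀ v ∈ V, φ v = 0 := by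
    have : IsClosed (V : Set E) := hV
    obtain ⟨ψ, hψ⟩ := SeparatingDual.exists_ne_zero (R := ℂ) (x := V.mkQ (f t))
      (by rwa [Ne, Submodule.mkQ_apply, Submodule.Quotient.mk_eq_zero])
    refine ⟨ψ.comp V.mkQL, hψ, fun v hv => ?_⟩
    change ψ (V.mkQ v) = 0
    rw [Submodule.mkQ_apply, (Submodule.Quotient.mk_eq_zero V).2 hv, map_zero]
  let g : C(UnitAddTorus (Fin k), ℂ) := ⟨fun t => φ (f t), φ.continuous.comp hf⟩
  have hg : mFourierCoeff g = 0 := by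
    funext n
    exact (map_mFourierCoeff φ hf n).symm.trans (hφV _ (h n))
  have hs := hasSum_mFourier_series_apply_of_summable (f := g) (by rw [hg]; exact summable_zero) t
  simp only [hg, Pi.zero_apply, zero_smul] at hs
  exact hφ (hs.unique hasSum_zero)

end

/-- The spectral projection of the algebra of `L` onto the elements of degree `n`. -/
def spectral (hL : IsKGraph L) (hF : IsRowFinite L) (n : Fin k → ℤ) : CStar L →L[ℂ] CStar L :=
  LinearMap.mkContinuous
    { toFun := fun a => mFourierCoeff (fun t => gauge t a) n
      map_add' := fun a b => by
        simp only [map_add]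
        exact mFourierCoeff_add (continuous_gauge hL hF a) (continuous_gauge hL hF b) n
      map_smul' := fun c a => by
        simp only [map_smul]
        exact mFourierCoeff_smul c _ n } 1 fun a => by
    rw [one_mul]
    exact norm_mFourierCoeff_le (fun t => norm_gauge_le t a) n

variable (hL : IsKGraph L) (hF : IsRowFinite L)

theorem spectral_apply (n : Fin k → ℤ) (a : CStar L) :
    spectral hL hF n a = mFourierCoeff (fun t => gauge t a) n := rfl

theorem norm_spectral_le (n : Fin k → ℤ) (a : CStar L) : ‖spectral hL hF n a‖ ≤ ‖a‖ :=
  norm_mFourierCoeff_le (fun t => norm_gauge_le t a) n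

theorem spectral_monomial (i : Fin k → ℤ) (m n : Mor L) :
    spectral hL hF i (gen m * star (gen n)) =
      if m.intDegree - n.intDegree = i then gen m * star (gen n) else 0 := by
  simp only [spectral_apply, gauge_monomial]
  exact mFourierCoeff_mFourier_smul _ _ _

/-- The pairs of paths with the same source and the difference `i` of the degrees. -/
def HasDegree (i : Fin k → ℤ) (m n : Mor L) : Prop :=
  m.source = n.source ∧ m.intDegree - n.intDegree = i

theorem spectral_mem (i : Fin k → ℤ) (a : CStar L) :
    spectral hL hF i a ∈ (pairSpan (HasDegree (L := L) i)).topologicalClosure := by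
  have ha : a ∈ (pairSpan fun m n : Mor L => m.source = n.source).topologicalClosure := by
    rw [dense_pairSpan hL hF]; trivial
  refine closure_minimal (t := spectral hL hF i ⁻¹'
    (pairSpan (HasDegree (L := L) i)).topologicalClosure) (fun b hb => ?_)
    (IsClosed.preimage (spectral hL hF i).continuous (Submodule.isClosed_topologicalClosure _)) ha
  refine Submodule.le_topologicalClosure _ ?_
  have : pairSpan (fun m n : Mor L => m.source = n.source) ≤
      (pairSpan (HasDegree (L := L) i)).comap (spectral hL hF i).toLinearMap := by
    refine Submodule.span_le.2 ?_
    rintro _ ⟨m, n, h, rfl⟩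
    change spectral hL hF i _ ∈ pairSpan _
    rw [spectral_monomial]
    split_ifs with h'
    · exact mem_pairSpan ⟨h, h'⟩
    · exact Submodule.zero_mem _
  exact this hb

/-- Elements that are fixed by the gauge action commute with the spectral components of the
elements with which they commute. -/
theorem spectral_commute {a p : CStar L} (hp : ∀ t, gauge t p = p) (h : a * p = p * a)
    (i : Fin k → ℤ) : spectral hL hF i a * p = p * spectral hL hF i a := by
  have hc := continuous_gauge hL hF a
  have h1 := map_mFourierCoeff (ContinuousLinearMap.mul ℂ (CStar L) p) hc i
  have h2 := map_mFourierCoeff ((ContinuousLinearMap.mul ℂ (CStar L)).flip p) hc i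
  refine h2.trans (Eq.trans (congrArg (mFourierCoeff · i) (funext fun t => ?_)) h1.symm)
  have := congrArg (gauge t) h
  rwa [map_mul, map_mul, hp] at this

/-- An element lies in a closed subspace if all its spectral components do. -/
theorem mem_of_spectral_mem {a : CStar L} {V : Submodule ℂ (CStar L)}
    (hV : IsClosed (V : Set (CStar L))) (h : ∀ i, spectral hL hF i a ∈ V) : a ∈ V := by
  have := mem_of_mFourierCoeff_mem (continuous_gauge hL hF a) hV h 0
  rwa [gauge_zero hL hF] at this

end KGraph

namespace KGraph

/-! ### Partial bijections as operators -/

section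

variable {X : Type*}

/-- The Hilbert space of square-summable functions on `X`. -/
abbrev EllTwo (X : Type*) := lp (fun _ : X => ℂ) 2

/-- The function `ξ` on `X`, carried along the partial bijection `f` and extended by zero. -/
def pushFun (f : X ≃. X) (ξ : X → ℂ) (y : X) : ℂ := (f.symm y).elim 0 ξ

theorem pushFun_of_mem {f : X ≃. X} {x y : X} (h : y ∈ f x) (ξ : X → ℂ) :
    pushFun f ξ y = ξ x := by
  have : f.symm y = some x := f.mem_iff_mem.2 h
  rw [pushFun, this]
  rfl

theorem pushFun_of_forall_notMem {f : X ≃. X} {y : X} (h : ∀ x, y ∉ f x) (ξ : X → ℂ) :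
    pushFun f ξ y = 0 := by
  have : f.symm y = none := Option.eq_none_iff_forall_not_mem.2 fun x hx =>
    h x (f.mem_iff_mem.1 hx)
  rw [pushFun, this]
  rfl

theorem sum_norm_pushFun_le (f : X ≃. X) (ξ : EllTwo X) (s : Finset X) :
    ∑ y ∈ s, ‖pushFun f ξ y‖ ^ (2 : ℝ≥0∞).toReal ≤ ‖ξ‖ ^ (2 : ℝ≥0∞).toReal := by
  classical
  have h0 : (0 : ℝ) < (2 : ℝ≥0∞).toReal := by norm_num
  have h1 : ∑ y ∈ s, ‖pushFun f ξ y‖ ^ (2 : ℝ≥0∞).toReal =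
      ∑ y ∈ s with (f.symm y).isSome, ‖pushFun f ξ y‖ ^ (2 : ℝ≥0∞).toReal := by
    refine (Finset.sum_filter_of_ne fun y _ hy => ?_).symm
    by_contra h
    rw [Option.not_isSome_iff_eq_none] at h
    apply hy
    rw [pushFun, h, Option.elim_none, norm_zero, Real.zero_rpow h0.ne']
  refine h1.trans_le (le_trans (le_of_eq ?_) (lp.sum_rpow_le_norm_rpow h0 ξ
    (s.filterMap f.symm fun a a' b h h' => f.symm.inj h h')))
  refine Finset.sum_bij' (fun y hy => (f.symm y).get (Finset.mem_filter.1 hy).2)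
    (fun x hx => (f x).get ?_) ?_ ?_ ?_ ?_ ?_
  · obtain ⟨y, -, hy⟩ := Finset.mem_filterMap _ |>.1 hx
    have : y ∈ f x := f.mem_iff_mem.1 hy
    rw [Option.mem_def.1 this]
    rfl
  · intro y hy
    exact (Finset.mem_filterMap _).2 ⟨y, (Finset.mem_filter.1 hy).1, by simp⟩
  · intro x hx
    obtain ⟨y, hys, hy⟩ := Finset.mem_filterMap _ |>.1 hx
    have : f x = some y := f.mem_iff_mem.1 hy
    simp only [this, Option.get_some]
    exact Finset.mem_filter.2 ⟨hys, by rw [hy]; rfl⟩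
  · intro y hy
    have h : f ((f.symm y).get (Finset.mem_filter.1 hy).2) = some y :=
      f.mem_iff_mem.1 (Option.get_mem _)
    simp only [h, Option.get_some]
  · intro x hx
    obtain ⟨y, hys, hy⟩ := Finset.mem_filterMap _ |>.1 hx
    have : f x = some y := f.mem_iff_mem.1 hy
    simp only [this, Option.get_some, hy]
  · intro y hy
    rw [pushFun_of_mem (f.mem_iff_mem.1 (Option.get_mem _))]

/-- The partial isometry of `ℓ²(X)` that permutes the basis vectors as the partial bijection `f`
does. -/
def pushOp (f : X ≃. X) : EllTwo X →L[ℂ] EllTwo X :=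
  LinearMap.mkContinuous
    { toFun := fun ξ => ⟨pushFun f ξ, memℓp_gen' (sum_norm_pushFun_le f ξ)⟩
      map_add' := fun ξ η => by
        ext y
        change (f.symm y).elim (0 : ℂ) ⇑(ξ + η) =
          (f.symm y).elim (0 : ℂ) ⇑ξ + (f.symm y).elim (0 : ℂ) ⇑η
        cases f.symm y
        · exact (add_zero (0 : ℂ)).symm
        · rfl
      map_smul' := fun c ξ => by
        ext y
        change (f.symm y).elim (0 : ℂ) ⇑(c • ξ) = c * (f.symm y).elim (0 : ℂ) ⇑ξ
        cases f.symm y <;> simp } 1 fun ξ => by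
    rw [one_mul]
    exact lp.norm_le_of_forall_sum_le (by norm_num) (norm_nonneg _) (sum_norm_pushFun_le f ξ)

theorem pushOp_of_mem {f : X ≃. X} {x y : X} (h : y ∈ f x) (ξ : EllTwo X) :
    pushOp f ξ y = ξ x := pushFun_of_mem h ξ

theorem pushOp_of_forall_notMem {f : X ≃. X} {y : X} (h : ∀ x, y ∉ f x) (ξ : EllTwo X) :
    pushOp f ξ y = 0 := pushFun_of_forall_notMem h ξ

theorem pushOp_mul (f g : X ≃. X) : pushOp f * pushOp g = pushOp (g.trans f) := by
  ext ξ y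
  change (f.symm y).elim 0 (fun z => (g.symm z).elim 0 ξ) = (((g.trans f).symm y).elim 0 ξ)
  change _ = Option.elim ((f.symm y).bind g.symm) 0 ξ
  cases f.symm y <;> rfl

open Classical in
/-- The basis vector at the point `x`. -/
def delta (x : X) : EllTwo X := lp.single 2 x 1

theorem norm_delta (x : X) : ‖delta x‖ = 1 := by
  classical
  simp [delta, lp.norm_single]

theorem delta_self (x : X) : delta x x = 1 := by
  classical
  exact lp.single_apply_self _ _ _

theorem delta_of_ne {x y : X} (h : y ≠ x) : delta x y = 0 := by
  classical
  exact lp.single_apply_ne _ _ _ h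

theorem pushOp_delta {f : X ≃. X} {x y : X} (h : y ∈ f x) : pushOp f (delta x) = delta y := by
  ext z
  by_cases hz : z = y
  · rw [hz, pushOp_of_mem h, delta_self, delta_self]
  rw [delta_of_ne hz]
  by_cases hz' : ∃ x', z ∈ f x'
  · obtain ⟨x', hx'⟩ := hz'
    rw [pushOp_of_mem hx', delta_of_ne]
    rintro rfl
    exact hz (Option.mem_unique hx' h)
  · exact pushOp_of_forall_notMem (not_exists.1 hz') _

theorem pushOp_delta_eq_zero {f : X ≃. X} {x : X} (h : ∀ y, y ∉ f x) :
    pushOp f (delta x) = 0 := by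
  ext z
  by_cases hz' : ∃ x', z ∈ f x'
  · obtain ⟨x', hx'⟩ := hz'
    rw [pushOp_of_mem hx', delta_of_ne]
    · rfl
    · rintro rfl
      exact h _ hx'
  · exact pushOp_of_forall_notMem (not_exists.1 hz') _

theorem star_pushOp (f : X ≃. X) : star (pushOp f) = pushOp f.symm := by
  classical
  have h1 (ξ : EllTwo X) (x : X) : ξ x = inner ℂ (delta x) ξ := by
    rw [delta, lp.inner_single_left]
    simp
  refine lp.ext_continuousLinearMap ENNReal.ofNat_ne_top fun x => ?_
  ext y
  change (star (pushOp f)) (delta x) y = pushOp f.symm (delta x) y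
  rw [h1, ContinuousLinearMap.star_eq_adjoint, ContinuousLinearMap.adjoint_inner_right]
  by_cases h : ∃ z, z ∈ f y
  · obtain ⟨z, hz⟩ := h
    rw [pushOp_delta hz, pushOp_of_mem (f.mem_iff_mem.2 hz), ← h1]
  · rw [pushOp_delta_eq_zero (not_exists.1 h), inner_zero_left, pushOp_of_forall_notMem]
    intro z hz
    exact h ⟨z, f.mem_iff_mem.1 hz⟩

end

variable {k : ℕ} {L : Type} [SmallCategory L] [DegreeFunctor k L]

/-! ### The path representation -/

open Classical in
/-- The partial bijection `x ↦ m x` of the space of infinite paths. -/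
def concatEquiv (hL : IsKGraph L) (m : Mor L) : InfPath L ≃. InfPath L where
  toFun x := if h : m.source = x.range then some (hL.exists_concat h).choose else none
  invFun y := if y.initial m.degree = m then some (y.shift m.degree) else none
  inv x y := by
    have h1 : y.initial m.degree = m ∧ y.shift m.degree = x ↔ IsConcat m x y := Iff.rfl
    constructor
    · intro h
      split_ifs at h with h2
      · have h3 : IsConcat m x y := ⟨h2, Option.some_injective _ h⟩
        rw [dif_pos h3.source_eq]
        exact congrArg some (hL.concat_unique (hL.exists_concat h3.source_eq).choose_spec h3)
    · intro h
      split_ifs at h with h2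
      · have h3 : IsConcat m x y := by
          have := (hL.exists_concat h2).choose_spec
          rwa [Option.some_injective _ h] at this
        rw [if_pos h3.1]
        exact congrArg some h3.2

open Classical in
theorem mem_concatEquiv {hL : IsKGraph L} {m : Mor L} {x y : InfPath L} :
    y ∈ concatEquiv hL m x ↔ IsConcat m x y := by
  rw [← PEquiv.mem_iff_mem]
  change x ∈ (if y.initial m.degree = m then some (y.shift m.degree) else none) ↔ _
  split_ifs with h
  · exact ⟨fun h' => ⟨h, Option.some_injective _ h'⟩, fun h' => congrArg some h'.2⟩
  · exact ⟨fun h' => (by cases h'), fun h' => (h h'.1).elim⟩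

theorem isConcat_vertex_iff {u : L} {x y : InfPath L} :
    IsConcat (.vertex u) x y ↔ x = y ∧ y.range = u := by
  constructor
  · intro h
    obtain rfl : y.range = u := h.range_eq
    exact ⟨h.left_unique (IsConcat.vertex y), rfl⟩
  · rintro ⟨rfl, rfl⟩
    exact IsConcat.vertex x

variable (hL : IsKGraph L)

theorem concatEquiv_comp (a b : Mor L) (h) :
    concatEquiv hL (a.comp b h) = (concatEquiv hL b).trans (concatEquiv hL a) := by
  refine PEquiv.ext fun x => Option.ext fun y => ?_
  rw [← Option.mem_def, ← Option.mem_def, mem_concatEquiv, hL.concat_comp_iff, PEquiv.mem_trans]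
  simp only [mem_concatEquiv]

/-- The representation of the Cuntz–Krieger relations on the space of square-summable functions
of infinite paths, in which `s_m` sends the basis vector at `x` to the one at `m x`. -/
def pathRep : CKRep L where
  H := EllTwo (InfPath L)
  op m := pushOp (concatEquiv hL m)
  isCuntzKrieger := by
    have hcomp (a b : Mor L) (h) : pushOp (concatEquiv hL (a.comp b h)) =
        pushOp (concatEquiv hL a) * pushOp (concatEquiv hL b) := by
      rw [concatEquiv_comp, pushOp_mul]
    refine ⟨fun u => ?_, fun u => ?_, fun u v h => ?_, fun {u v w} f g => ?_, fun m => ?_,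
      fun u n F hF => ?_⟩
    · rw [star_pushOp]
      congr 1
      refine PEquiv.ext fun x => Option.ext fun y => ?_
      rw [← Option.mem_def, ← Option.mem_def, PEquiv.mem_iff_mem, mem_concatEquiv, mem_concatEquiv,
        isConcat_vertex_iff, isConcat_vertex_iff]
      exact ⟨fun ⟨h, h'⟩ => ⟨h.symm, h ▸ h'⟩, fun ⟨h, h'⟩ => ⟨h.symm, h ▸ h'⟩⟩
    · exact (hcomp _ _ rfl).symm.trans (congrArg (fun m => pushOp (concatEquiv hL m))
        (Mor.vertex_comp (.vertex u) u rfl))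
    · rw [pushOp_mul]
      ext ξ y
      refine pushOp_of_forall_notMem (fun x hx => ?_) _
      obtain ⟨z, h1, h2⟩ := (PEquiv.mem_trans _ _ _ _).1 hx
      obtain ⟨rfl, h1⟩ := isConcat_vertex_iff.1 (mem_concatEquiv.1 h1)
      obtain ⟨rfl, h2⟩ := isConcat_vertex_iff.1 (mem_concatEquiv.1 h2)
      exact h (h2.symm.trans h1)
    · rw [← hcomp _ _ rfl, Mor.comp_mk]
    · rw [star_pushOp, pushOp_mul]
      congr 1
      refine PEquiv.ext fun x => Option.ext fun y => ?_
      rw [← Option.mem_def, ← Option.mem_def, PEquiv.mem_trans, mem_concatEquiv,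
        isConcat_vertex_iff]
      simp only [PEquiv.mem_iff_mem, mem_concatEquiv]
      constructor
      · rintro ⟨z, h1, h2⟩
        exact ⟨h1.left_unique h2, h2.source_eq.symm⟩
      · rintro ⟨rfl, h⟩
        obtain ⟨z, hz⟩ := hL.exists_concat h.symm
        exact ⟨z, hz, hz⟩
    · have h1 (m : Mor L) (ξ : EllTwo (InfPath L)) (y : InfPath L) (h : y.initial m.degree = m) :
          (pushOp (concatEquiv hL m) * star (pushOp (concatEquiv hL m))) ξ y = ξ y := by
        rw [star_pushOp, pushOp_mul]
        have h2 := mem_concatEquiv (hL := hL).2 (IsConcat.of_initial h)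
        exact pushOp_of_mem ((PEquiv.mem_trans _ _ _ _).2 ⟨_, (PEquiv.mem_iff_mem _).2 h2, h2⟩) ξ
      have h2 (m : Mor L) (ξ : EllTwo (InfPath L)) (y : InfPath L) (h : y.initial m.degree ≠ m) :
          (pushOp (concatEquiv hL m) * star (pushOp (concatEquiv hL m))) ξ y = 0 := by
        rw [star_pushOp, pushOp_mul]
        refine pushOp_of_forall_notMem (fun x hx => h ?_) ξ
        obtain ⟨z, -, h2⟩ := (PEquiv.mem_trans _ _ _ _).1 hx
        exact (mem_concatEquiv.1 h2).1
      ext ξ y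
      rw [sum_apply, lp.coeFn_sum, Finset.sum_apply]
      by_cases hy : y.range = u
      · rw [pushOp_of_mem (mem_concatEquiv.2 (isConcat_vertex_iff.2 ⟨rfl, hy⟩)),
          Finset.sum_eq_single (y.initial n)]
        · exact (h1 _ _ _ (by rw [InfPath.degree_initial])).symm
        · intro m hm hne
          refine h2 _ _ _ fun e => hne ?_
          rw [← ((hF m).1 hm).2, e]
        · intro h
          exact (h ((hF _).2 ⟨hy, InfPath.degree_initial _ _⟩)).elim
      · rw [pushOp_of_forall_notMem, Finset.sum_eq_zero]
        · intro m hm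
          refine h2 _ _ _ fun e => hy ?_
          rw [← ((hF m).1 hm).1, ← e]
          rfl
        · intro x hx
          exact hy (isConcat_vertex_iff.1 (mem_concatEquiv.1 hx)).2

/-- The action of the algebra of `L` on the square-summable functions of infinite paths. -/
def pathAct : CStar L →⋆ₙₐ[ℂ] (EllTwo (InfPath L) →L[ℂ] EllTwo (InfPath L)) := (pathRep hL).rep

theorem norm_pathAct_le (a : CStar L) : ‖pathAct hL a‖ ≤ ‖a‖ := (pathRep hL).norm_rep_le a

theorem pathAct_gen (m : Mor L) : pathAct hL (gen m) = pushOp (concatEquiv hL m) := rfl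

theorem pathAct_monomial (m n : Mor L) : pathAct hL (gen m * star (gen n)) =
    pushOp ((concatEquiv hL n).symm.trans (concatEquiv hL m)) := by
  rw [map_mul, map_star, pathAct_gen, pathAct_gen, star_pushOp, pushOp_mul]

theorem pathAct_monomial_delta {m n : Mor L} {x y z : InfPath L} (h : IsConcat m x y)
    (h' : IsConcat n x z) : pathAct hL (gen m * star (gen n)) (delta z) = delta y := by
  rw [pathAct_monomial]
  exact pushOp_delta ((PEquiv.mem_trans _ _ _ _).2
    ⟨x, (PEquiv.mem_iff_mem _).2 (mem_concatEquiv.2 h'), mem_concatEquiv.2 h⟩)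

theorem pathAct_monomial_delta_eq_zero {m n : Mor L} {z : InfPath L}
    (h : ∀ x y, IsConcat n x z → ¬ IsConcat m x y) :
    pathAct hL (gen m * star (gen n)) (delta z) = 0 := by
  rw [pathAct_monomial]
  refine pushOp_delta_eq_zero fun y hy => ?_
  obtain ⟨x, h1, h2⟩ := (PEquiv.mem_trans _ _ _ _).1 hy
  exact h x y (mem_concatEquiv.1 ((PEquiv.mem_iff_mem _).1 h1)) (mem_concatEquiv.1 h2)

end KGraph

namespace KGraph

/-! ### Block-diagonal operators -/

section

variable {ι H : Type*} [NormedAddCommGroup H] [InnerProductSpace ℂ H]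

theorem norm_sum_sq_of_orthogonal (s : Finset ι) (v : ι → H)
    (h : ∀ i ∈ s, ∀ j ∈ s, i ≠ j → inner ℂ (v i) (v j) = 0) :
    ‖∑ i ∈ s, v i‖ ^ 2 = ∑ i ∈ s, ‖v i‖ ^ 2 := by
  rw [← inner_self_eq_norm_sq (𝕜 := ℂ), sum_inner, map_sum]
  refine Finset.sum_congr rfl fun i hi => ?_
  rw [inner_sum, Finset.sum_eq_single i (fun j hj hne => h i hi j hj hne.symm)
    (fun h => (h hi).elim), inner_self_eq_norm_sq]

variable [CompleteSpace H]

/-- A block-diagonal operator has norm at most `C` if each of its blocks does. -/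
theorem norm_block_sum_le (s : Finset ι) (p b : ι → H →L[ℂ] H) (hs : ∀ i ∈ s, star (p i) = p i)
    (hi : ∀ i ∈ s, p i * p i = p i) (ho : ∀ i ∈ s, ∀ j ∈ s, i ≠ j → p i * p j = 0) {C : ℝ}
    (hC : 0 ≤ C) (hb : ∀ i ∈ s, ‖p i * b i * p i‖ ≤ C) : ‖∑ i ∈ s, p i * b i * p i‖ ≤ C := by
  have horth (ξ η : H) (i) (his : i ∈ s) (j) (hjs : j ∈ s) (hij : i ≠ j) :
      inner ℂ (p i ξ) (p j η) = 0 := by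
    rw [← ContinuousLinearMap.adjoint_inner_right, ← ContinuousLinearMap.star_eq_adjoint,
      hs i his]
    have : p i (p j η) = 0 := congrArg (· η) (ho i his j hjs hij)
    rw [this, inner_zero_right]
  have hbessel (ξ : H) : ∑ i ∈ s, ‖p i ξ‖ ^ 2 ≤ ‖ξ‖ ^ 2 := by
    have h1 : ‖∑ i ∈ s, p i ξ‖ ^ 2 = ∑ i ∈ s, ‖p i ξ‖ ^ 2 :=
      norm_sum_sq_of_orthogonal s _ fun i hi j hj h => horth _ _ i hi j hj h
    have h2 : ∑ i ∈ s, ‖p i ξ‖ ^ 2 = RCLike.re (inner ℂ (∑ i ∈ s, p i ξ) ξ) := by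
      rw [sum_inner, map_sum]
      refine Finset.sum_congr rfl fun i his => ?_
      have h3 : p i (p i ξ) = p i ξ := congrArg (· ξ) (hi i his)
      rw [← inner_self_eq_norm_sq (𝕜 := ℂ), ← ContinuousLinearMap.adjoint_inner_left,
        ← ContinuousLinearMap.star_eq_adjoint, hs i his, h3]
    have h3 : ‖∑ i ∈ s, p i ξ‖ ^ 2 ≤ ‖∑ i ∈ s, p i ξ‖ * ‖ξ‖ := by
      rw [h1, h2]
      exact re_inner_le_norm _ _
    rw [← h1]
    nlinarith [norm_nonneg (∑ i ∈ s, p i ξ), norm_nonneg ξ,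
      sq_nonneg (‖∑ i ∈ s, p i ξ‖ - ‖ξ‖)]
  refine ContinuousLinearMap.opNorm_le_bound _ hC fun ξ => ?_
  have h1 (i) (his : i ∈ s) : (p i * b i * p i) ξ = (p i * b i * p i) (p i ξ) := by
    change _ = (p i * b i * p i * p i) ξ
    rw [mul_assoc (p i * b i), hi i his]
  have h2 : ‖(∑ i ∈ s, p i * b i * p i) ξ‖ ^ 2 ≤ (C * ‖ξ‖) ^ 2 := by
    rw [sum_apply, norm_sum_sq_of_orthogonal s (fun i => (p i * b i * p i) ξ)
      fun i hi j hj h => horth _ _ i hi j hj h, mul_pow]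
    refine le_trans ?_ (mul_le_mul_of_nonneg_left (hbessel ξ) (sq_nonneg C))
    rw [Finset.mul_sum]
    refine Finset.sum_le_sum fun i his => ?_
    rw [h1 i his, ← mul_pow]
    exact pow_le_pow_left₀ (norm_nonneg _) ((ContinuousLinearMap.le_opNorm _ _).trans
      (mul_le_mul_of_nonneg_right (hb i his) (norm_nonneg _))) 2
  exact (pow_le_pow_iff_left₀ (norm_nonneg _) (by positivity) two_ne_zero).1 h2

end

variable {k : ℕ} {L : Type} [SmallCategory L] [DegreeFunctor k L]

/-! ### Range projections and compressions -/

theorem norm_gen_le (m : Mor L) : ‖gen m‖ ≤ 1 :=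
  norm_le_of_rep zero_le_one fun R => R.norm_op_le_one m

theorem norm_monomial_le (m n : Mor L) : ‖gen m * star (gen n)‖ ≤ 1 :=
  (norm_mul_le _ _).trans (by
    rw [norm_star]
    exact mul_le_one₀ (norm_gen_le m) (norm_nonneg _) (norm_gen_le n))

/-- The range projection `s_m s_m^*`. -/
def proj (m : Mor L) : CStar L := gen m * star (gen m)

theorem star_proj (m : Mor L) : star (proj m) = proj m := by
  rw [proj, star_mul, star_star]

theorem proj_mul_gen (m : Mor L) : proj m * gen m = gen m := by
  rw [proj, mul_assoc, star_gen_mul_self, gen_mul_vertex]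

theorem proj_mul_self (m : Mor L) : proj m * proj m = proj m := by
  conv_lhs => enter [2]; rw [proj]
  rw [← mul_assoc, proj_mul_gen, proj]

theorem norm_proj_le (m : Mor L) : ‖proj m‖ ≤ 1 := norm_monomial_le m m

theorem proj_mul_proj_of_ne (hF : IsRowFinite L) {m n : Mor L} (hd : m.degree = n.degree)
    (h : m ≠ n) : proj m * proj n = 0 := by
  rw [proj, proj, mul_assoc, ← mul_assoc (star _), star_gen_mul_gen_of_ne hF hd h]
  simp

theorem gauge_proj (t) (m : Mor L) : gauge t (proj m) = proj m := by
  rw [proj, gauge_monomial, sub_self, UnitAddTorus.mFourier_zero]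
  exact one_smul _ _

/-- The finite set of the paths of degree `n`, in a `k`-graph with finitely many vertices. -/
def IsRowFinite.allPaths [Finite L] (hF : IsRowFinite L) (n : Fin k → ℕ) : Finset (Mor L) :=
  ((Set.finite_iUnion fun u => hF u n).subset
    (fun m (h : m.degree = n) => Set.mem_iUnion.2 ⟨m.range, rfl, h⟩) :
      {m : Mor L | m.degree = n}.Finite).toFinset

theorem IsRowFinite.mem_allPaths [Finite L] (hF : IsRowFinite L) {n : Fin k → ℕ} {m : Mor L} :
    m ∈ hF.allPaths n ↔ m.degree = n := Set.Finite.mem_toFinset _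

/-- The sum of the compressions to the range projections of all paths of degree `n`. -/
def compress [Finite L] (hF : IsRowFinite L) (n : Fin k → ℕ) (a : CStar L) : CStar L :=
  ∑ m ∈ hF.allPaths n, proj m * a * proj m

section

variable [Finite L] (hF : IsRowFinite L)

theorem compress_add (n : Fin k → ℕ) (a b : CStar L) :
    compress hF n (a + b) = compress hF n a + compress hF n b := by
  simp only [compress, mul_add, add_mul, Finset.sum_add_distrib]

theorem compress_sub (n : Fin k → ℕ) (a b : CStar L) :
    compress hF n (a - b) = compress hF n a - compress hF n b := by
  simp only [compress, mul_sub, sub_mul, Finset.sum_sub_distrib]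

/-- A compression has norm at most `C` if each of its blocks does. -/
theorem norm_compress_le_of_block {n : Fin k → ℕ} {a : CStar L} {C : ℝ} (hC : 0 ≤ C)
    (h : ∀ m : Mor L, m.degree = n → ‖proj m * a * proj m‖ ≤ C) : ‖compress hF n a‖ ≤ C := by
  refine norm_le_of_rep hC fun R => ?_
  rw [compress, map_sum]
  simp only [map_mul]
  refine norm_block_sum_le _ (fun m => R.rep (proj m)) (fun _ => R.rep a) ?_ ?_ ?_ hC ?_
  · intro m _
    rw [← map_star, star_proj]
  · intro m _
    rw [← map_mul, proj_mul_self]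
  · intro m hm m' hm' hne
    rw [← map_mul, proj_mul_proj_of_ne hF
      ((hF.mem_allPaths.1 hm).trans (hF.mem_allPaths.1 hm').symm) hne, map_zero]
  · intro m hm
    simp only [← map_mul]
    exact (R.norm_rep_le _).trans (h m (hF.mem_allPaths.1 hm))

theorem norm_compress_le (n : Fin k → ℕ) (a : CStar L) : ‖compress hF n a‖ ≤ ‖a‖ :=
  norm_compress_le_of_block hF (norm_nonneg a) fun m _ => by
    have h1 := norm_proj_le m
    have h2 : ‖proj m * a‖ ≤ ‖a‖ := (norm_mul_le _ _).trans
      (mul_le_of_le_one_left (norm_nonneg _) h1)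
    exact (norm_mul_le _ _).trans ((mul_le_of_le_one_right (norm_nonneg _) h1).trans h2)

theorem sum_proj_mul (hL : IsKGraph L) (n : Fin k → ℕ) (a : CStar L) :
    (∑ m ∈ hF.allPaths n, proj m) * a = a := by
  have h1 (b : Mor L) : (∑ m ∈ hF.allPaths n, proj m) * gen b = gen b := by
    conv_rhs => rw [← gen_vertex_mul b, gen_vertex_eq_sum hF _ n]
    rw [Finset.sum_mul, Finset.sum_mul]
    refine (Finset.sum_subset (fun m hm => ?_) fun m _ hm' => ?_).symm
    · exact hF.mem_allPaths.2 ((hF.mem_paths m).1 hm).2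
    · rename_i hm
      rw [proj, mul_assoc, star_gen_mul_gen_of_range_ne, mul_zero]
      exact fun h => hm' ((hF.mem_paths m).2 ⟨h, hF.mem_allPaths.1 hm⟩)
  have ha : a ∈ (pairSpan fun m n : Mor L => m.source = n.source).topologicalClosure := by
    rw [dense_pairSpan hL hF]; trivial
  refine closure_minimal (t := {a | (∑ m ∈ hF.allPaths n, proj m) * a = a}) (fun b hb => ?_)
    (isClosed_eq (continuous_const.mul continuous_id) continuous_id) ha
  refine Submodule.span_induction (p := fun b _ => (∑ m ∈ hF.allPaths n, proj m) * b = b)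
    ?_ (mul_zero _) ?_ ?_ hb
  · rintro _ ⟨m, n, -, rfl⟩
    rw [← mul_assoc, h1]
  · intro x y _ _ hx hy
    rw [mul_add, hx, hy]
  · intro c x _ hx
    rw [mul_smul_comm, hx]

theorem compress_eq_self (hL : IsKGraph L) (n : Fin k → ℕ) {a : CStar L}
    (ha : ∀ m, a * proj m = proj m * a) : compress hF n a = a := by
  conv_rhs => rw [← sum_proj_mul hF hL n a, Finset.sum_mul]
  refine Finset.sum_congr rfl fun m _ => ?_
  rw [mul_assoc, ha, ← mul_assoc, proj_mul_self]

end

/-! ### Homogeneous elements and their coefficients -/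

/-- Pairs of paths with the same source and with prescribed degrees. -/
def HasBidegree (p q : Fin k → ℕ) (m n : Mor L) : Prop :=
  m.source = n.source ∧ m.degree = p ∧ n.degree = q

/-- A monomial `s_m s_n^*` is the sum of the monomials `s_{m a} s_{n a}^*` over the paths `a` of
degree `r`. -/
theorem pairSpan_hasBidegree_le (hF : IsRowFinite L) (p q r : Fin k → ℕ) :
    pairSpan (HasBidegree (L := L) p q) ≤ pairSpan (HasBidegree (L := L) (p + r) (q + r)) := by
  refine Submodule.span_le.2 ?_
  rintro _ ⟨m, n, ⟨h, hm, hn⟩, rfl⟩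
  have h1 : gen m * star (gen n) =
      ∑ a ∈ hF.paths m.source r, gen m * gen a * star (gen n * gen a) := by
    conv_lhs => rw [← gen_mul_vertex m, gen_vertex_eq_sum hF _ r]
    simp only [Finset.mul_sum, Finset.sum_mul, star_mul, mul_assoc]
  rw [h1]
  refine Submodule.sum_mem _ fun a ha => ?_
  obtain ⟨h2, h3⟩ := (hF.mem_paths a).1 ha
  rw [← gen_comp m a h2.symm, ← gen_comp n a (h.symm.trans h2.symm)]
  exact mem_pairSpan ⟨rfl, by rw [Mor.degree_comp, hm, h3], by rw [Mor.degree_comp, hn, h3]⟩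

/-- The monomials of a combination of monomials of one degree can be refined to a common
bidegree. -/
theorem exists_mem_pairSpan_hasBidegree (hF : IsRowFinite L) {i : Fin k → ℤ} {a : CStar L}
    (ha : a ∈ pairSpan (HasDegree (L := L) i)) :
    ∃ p q : Fin k → ℕ, a ∈ pairSpan (HasBidegree (L := L) p q) := by
  suffices h : ∃ p q : Fin k → ℕ, (∀ j, (p j : ℤ) - q j = i j) ∧
      a ∈ pairSpan (HasBidegree (L := L) p q) by
    obtain ⟨p, q, -, h⟩ := h
    exact ⟨p, q, h⟩
  refine Submodule.span_induction (p := fun a _ => ∃ p q : Fin k → ℕ,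
    (∀ j, (p j : ℤ) - q j = i j) ∧ a ∈ pairSpan (HasBidegree (L := L) p q)) ?_ ?_ ?_ ?_ ha
  · rintro _ ⟨m, n, ⟨h, hd⟩, rfl⟩
    exact ⟨m.degree, n.degree, fun j => congrFun hd j, mem_pairSpan ⟨h, rfl, rfl⟩⟩
  · exact ⟨fun j => (i j).toNat, fun j => (-i j).toNat, fun j => by
      have : ((i j).toNat : ℤ) - (-i j).toNat = i j := by omega
      exact this,
      Submodule.zero_mem _⟩
  · rintro x y _ _ ⟨p, q, h, hx⟩ ⟨p', q', h', hy⟩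
    have e1 : p + q' = p' + q := by
      funext j
      have := h j
      have := h' j
      simp only [Pi.add_apply]
      omega
    refine ⟨p + q', q + q', fun j => ?_, Submodule.add_mem _ ?_ ?_⟩
    · rw [← h j]
      simp
    · exact pairSpan_hasBidegree_le hF p q q' hx
    · rw [e1, add_comm q q']
      exact pairSpan_hasBidegree_le hF p' q' q hy
  · rintro c x _ ⟨p, q, h, hx⟩
    exact ⟨p, q, h, Submodule.smul_mem _ _ hx⟩

theorem exists_coeff_of_mem_pairSpan {T : Mor L → Mor L → Prop} {a : CStar L}
    (ha : a ∈ pairSpan T) : ∃ c : Mor L × Mor L →₀ ℂ, (∀ x ∈ c.support, T x.1 x.2) ∧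
      a = ∑ x ∈ c.support, c x • (gen x.1 * star (gen x.2)) := by
  have h1 : {a | ∃ m n : Mor L, T m n ∧ a = gen m * star (gen n)} =
      (fun x : Mor L × Mor L => gen x.1 * star (gen x.2)) '' {x | T x.1 x.2} := by
    ext b
    constructor
    · rintro ⟨m, n, h, rfl⟩
      exact ⟨(m, n), h, rfl⟩
    · rintro ⟨⟨m, n⟩, h, rfl⟩
      exact ⟨m, n, h, rfl⟩
  rw [pairSpan, h1, Finsupp.mem_span_image_iff_linearCombination] at ha
  obtain ⟨c, hc, rfl⟩ := ha
  exact ⟨c, fun x hx => hc hx, rfl⟩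

variable (hL : IsKGraph L)

/-- The coefficients of a combination of monomials of the same bidegree are matrix coefficients of
the path representation. -/
theorem pathAct_apply_eq_coeff {p q : Fin k → ℕ} {c : Mor L × Mor L →₀ ℂ}
    (hc : ∀ x ∈ c.support, HasBidegree p q x.1 x.2) {m n : Mor L} (hmn : HasBidegree p q m n)
    {x y z : InfPath L} (hy : IsConcat m x y) (hz : IsConcat n x z) :
    pathAct hL (∑ x ∈ c.support, c x • (gen x.1 * star (gen x.2))) (delta z) y = c (m, n) := by
  rw [map_sum, sum_apply, lp.coeFn_sum, Finset.sum_apply, Finset.sum_eq_single (m, n)]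
  · rw [map_smul]
    change c (m, n) * pathAct hL (gen m * star (gen n)) (delta z) y = _
    rw [pathAct_monomial_delta hL hy hz, delta_self, mul_one]
  · rintro ⟨m', n'⟩ hs hne
    rw [map_smul]
    change c (m', n') * pathAct hL (gen m' * star (gen n')) (delta z) y = 0
    obtain ⟨-, h1, h2⟩ := hc _ hs
    obtain ⟨-, h3, h4⟩ := hmn
    by_cases h : ∃ x' y', IsConcat n' x' z ∧ IsConcat m' x' y'
    · obtain ⟨x', y', h5, h6⟩ := h
      rw [pathAct_monomial_delta hL h6 h5, delta_of_ne, mul_zero]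
      rintro rfl
      refine hne (Prod.ext ?_ ?_)
      · rw [← h6.1, ← hy.1, h1, h3]
      · rw [← h5.1, ← hz.1, h2, h4]
    · rw [pathAct_monomial_delta_eq_zero hL (fun x' y' h5 h6 => h ⟨x', y', h5, h6⟩)]
      exact mul_zero _
  · intro h
    rw [Finsupp.notMem_support_iff.1 h, zero_smul, map_zero]
    rfl

/-- The path representation is faithful on the combinations of monomials of one degree. -/
theorem eq_zero_of_pathAct_eq_zero (hF : IsRowFinite L)
    (hne : ∀ u : L, ∃ x : InfPath L, x.range = u) {i : Fin k → ℤ} {a : CStar L}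
    (ha : a ∈ pairSpan (HasDegree (L := L) i)) (h : ∀ z, pathAct hL a (delta z) = 0) : a = 0 := by
  obtain ⟨p, q, hpq⟩ := exists_mem_pairSpan_hasBidegree hF ha
  obtain ⟨c, hc, rfl⟩ := exists_coeff_of_mem_pairSpan hpq
  refine Finset.sum_eq_zero fun x hx => ?_
  obtain ⟨w, hw⟩ := hne x.1.source
  obtain ⟨y, hy⟩ := hL.exists_concat hw.symm
  obtain ⟨z, hz⟩ := hL.exists_concat ((hc x hx).1.symm.trans hw.symm)
  rw [← pathAct_apply_eq_coeff hL hc (hc x hx) hy hz, h]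
  exact zero_smul _ _

/-- An element that commutes with the range projections acts on the path representation by a
diagonal operator. -/
theorem pathAct_apply_eq_zero_of_commute {a : CStar L} (ha : ∀ m, a * proj m = proj m * a)
    {y z : InfPath L} (h : y ≠ z) : pathAct hL a (delta z) y = 0 := by
  obtain ⟨N, hN⟩ : ∃ N, y.initial N ≠ z.initial N := by
    by_contra! h'
    exact h (hL.infPath_ext fun n => ⟨n, le_rfl, h' n⟩)
  have h1 := IsConcat.initial_shift z N
  have h2 : pathAct hL (proj (z.initial N)) (delta z) = delta z :=
    pathAct_monomial_delta hL h1 h1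
  have h3 : pathAct hL a (delta z) =
      pathAct hL (proj (z.initial N)) (pathAct hL a (delta z)) := by
    conv_lhs => rw [← h2]
    have := congrArg (pathAct hL) (ha (z.initial N))
    rw [map_mul, map_mul] at this
    exact congrArg (· (delta z)) this
  rw [h3, proj, pathAct_monomial]
  refine pushOp_of_forall_notMem (fun x hx => hN ?_) _
  obtain ⟨w, -, h4⟩ := (PEquiv.mem_trans _ _ _ _).1 hx
  have := (mem_concatEquiv.1 h4).1
  rwa [InfPath.degree_initial] at this

/-! ### The cycline subalgebra is maximal abelian -/

theorem cyclineSpan_eq : cyclineSpan L = (pairSpan (IsCycline (L := L))).topologicalClosure := by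
  rw [cyclineSpan, pairSpan]
  simp only [IsCycline, and_assoc]

theorem proj_mul_gen_of_not_isPrefix (hL : IsKGraph L) (hF : IsRowFinite L) {a c : Mor L}
    (hd : a.degree ≤ c.degree) (h : ¬ a.IsPrefix c) : proj c * gen a = 0 := by
  have := star_gen_mul_gen_of_not_isPrefix hL hF hd h
  rw [proj, mul_assoc, ← star_star (gen a), ← star_mul, this, star_zero, mul_zero]

theorem star_gen_mul_proj_of_not_isPrefix (hL : IsKGraph L) (hF : IsRowFinite L) {a c : Mor L}
    (hd : a.degree ≤ c.degree) (h : ¬ a.IsPrefix c) : star (gen a) * proj c = 0 := by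
  rw [proj, ← mul_assoc, star_gen_mul_gen_of_not_isPrefix hL hF hd h, zero_mul]

/-- A homogeneous element that commutes with the range projections lies in the cycline subalgebra.
It is close to a combination of monomials of one bidegree, in which the coefficients of the
monomials that are not cycline are small, because they are off-diagonal matrix coefficients of the
path representation. The compression to the range projections of long paths then makes these
monomials mutually orthogonal. -/
theorem mem_cyclineSpan_of_homogeneous [Finite L] (hL : IsKGraph L) (hF : IsRowFinite L)
    {i : Fin k → ℤ} {a : CStar L} (hi : a ∈ (pairSpan (HasDegree (L := L) i)).topologicalClosure)
    (ha : ∀ m, a * proj m = proj m * a) : a ∈ cyclineSpan L := by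
  classical
  rw [cyclineSpan_eq]
  refine Metric.mem_closure_iff.2 fun ε hε => ?_
  obtain ⟨a', ha', haa'⟩ := Metric.mem_closure_iff.1 hi (ε / 3) (by positivity)
  rw [dist_eq_norm] at haa'
  obtain ⟨p, q, hpq⟩ := exists_mem_pairSpan_hasBidegree hF ha'
  obtain ⟨c, hc, hc'⟩ := exists_coeff_of_mem_pairSpan hpq
  set b := ∑ x ∈ c.support with IsCycline x.1 x.2, c x • (gen x.1 * star (gen x.2)) with hb
  set d := ∑ x ∈ c.support with ¬ IsCycline x.1 x.2, c x • (gen x.1 * star (gen x.2)) with hd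
  have hbd : a' = b + d := by
    rw [hc', hb, hd, Finset.sum_filter_add_sum_filter_not]
  have hcoeff (x) (hx : x ∈ c.support) (hx' : ¬ IsCycline x.1 x.2) : ‖c x‖ ≤ ε / 3 := by
    obtain ⟨w, y, z, hy, hz, hne⟩ : ∃ w y z, IsConcat x.1 w y ∧ IsConcat x.2 w z ∧ y ≠ z := by
      by_contra! h
      refine hx' ⟨(hc x hx).1, fun w hw => ?_⟩
      obtain ⟨y, hy⟩ := hL.exists_concat hw.symm
      obtain ⟨z, hz⟩ := hL.exists_concat ((hc x hx).1.symm.trans hw.symm)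
      obtain rfl := h w y z hy hz
      exact ⟨y, hy, hz⟩
    have h1 := pathAct_apply_eq_coeff hL hc (hc x hx) hy hz
    rw [← hc'] at h1
    have h2 : pathAct hL (a' - a) (delta z) y = c x := by
      rw [map_sub]
      change pathAct hL a' (delta z) y - pathAct hL a (delta z) y = _
      rw [h1, pathAct_apply_eq_zero_of_commute hL ha hne, sub_zero]
    rw [← h2]
    refine (lp.norm_apply_le_norm two_ne_zero _ y).trans
      ((ContinuousLinearMap.le_opNorm _ _).trans ?_)
    rw [norm_delta, mul_one]
    refine (norm_pathAct_le hL _).trans ?_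
    rw [norm_sub_rev]
    exact haa'.le
  have hblock (m : Mor L) (hm : m.degree = p + q) : ‖proj m * d * proj m‖ ≤ ε / 3 := by
    have h1 : proj m * d * proj m = ∑ x ∈ c.support with ¬ IsCycline x.1 x.2,
        c x • (proj m * (gen x.1 * star (gen x.2)) * proj m) := by
      rw [hd, Finset.mul_sum, Finset.sum_mul]
      simp only [mul_smul_comm, smul_mul_assoc]
    have h2 (x) (hx : x ∈ c.support) (h : ¬ (x.1.IsPrefix m ∧ x.2.IsPrefix m)) :
        proj m * (gen x.1 * star (gen x.2)) * proj m = 0 := by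
      obtain ⟨-, h3, h4⟩ := hc x hx
      by_cases h5 : x.1.IsPrefix m
      · rw [mul_assoc, mul_assoc, star_gen_mul_proj_of_not_isPrefix hL hF
          (by rw [h4, hm]; exact le_add_self) fun h6 => h ⟨h5, h6⟩]
        simp
      · rw [← mul_assoc, proj_mul_gen_of_not_isPrefix hL hF
          (by rw [h3, hm]; exact le_self_add) h5]
        simp
    rw [h1]
    by_cases h3 : ∃ x ∈ c.support.filter (fun x => ¬ IsCycline x.1 x.2),
        x.1.IsPrefix m ∧ x.2.IsPrefix m
    · obtain ⟨x, hx, hx1, hx2⟩ := h3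
      have hxs := (Finset.mem_filter.1 hx).1
      rw [Finset.sum_eq_single x]
      · rw [norm_smul]
        have h4 : ‖proj m * (gen x.1 * star (gen x.2)) * proj m‖ ≤ 1 := by
          refine (norm_mul_le _ _).trans (mul_le_one₀ ((norm_mul_le _ _).trans
            (mul_le_one₀ (norm_proj_le m) (norm_nonneg _) (norm_monomial_le _ _)))
            (norm_nonneg _) (norm_proj_le m))
        exact (mul_le_of_le_one_right (norm_nonneg _) h4).trans
          (hcoeff x hxs (Finset.mem_filter.1 hx).2)
      · intro x' hx' hne
        have hxs' := (Finset.mem_filter.1 hx').1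
        rw [h2 x' hxs', smul_zero]
        rintro ⟨h4, h5⟩
        exact hne (Prod.ext
          (hL.prefix_unique h4 hx1 ((hc x' hxs').2.1.trans (hc x hxs).2.1.symm))
          (hL.prefix_unique h5 hx2 ((hc x' hxs').2.2.trans (hc x hxs).2.2.symm)))
      · exact fun h => (h hx).elim
    · rw [Finset.sum_eq_zero]
      · rw [norm_zero]; positivity
      · intro x hx
        rw [h2 x (Finset.mem_filter.1 hx).1 fun h => h3 ⟨x, hx, h⟩, smul_zero]
  refine ⟨compress hF (p + q) b, ?_, ?_⟩
  · have h1 : b ∈ pairAlgebra hL hF (isPairRel_isCycline hL) :=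
      Submodule.sum_mem (pairSpan IsCycline) fun x hx =>
        Submodule.smul_mem _ _ (mem_pairSpan (Finset.mem_filter.1 hx).2)
    have h2 (m : Mor L) : proj m ∈ pairAlgebra hL hF (isPairRel_isCycline hL) :=
      mem_pairSpan (hL.isCycline_refl m)
    have h3 (m : Mor L) : proj m * b * proj m ∈ pairAlgebra hL hF (isPairRel_isCycline hL) :=
      mul_mem (mul_mem (h2 m) h1) (h2 m)
    exact Submodule.sum_mem (pairSpan IsCycline) fun m _ => h3 m
  · have h1 : a - compress hF (p + q) b =
        compress hF (p + q) (a - a') + compress hF (p + q) d := by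
      rw [compress_sub, compress_eq_self hF hL _ ha, hbd, compress_add]
      abel
    rw [dist_eq_norm, h1]
    have h2 := norm_compress_le hF (p + q) (a - a')
    have h3 := norm_compress_le_of_block hF (by positivity) hblock
    have h4 := norm_add_le (compress hF (p + q) (a - a')) (compress hF (p + q) d)
    linarith

/-- The elements that commute with all range projections lie in the cycline subalgebra. In
particular, this subalgebra contains every commutative algebra in which it is contained. -/
theorem mem_cyclineSpan_of_commute [Finite L] (hL : IsKGraph L) (hF : IsRowFinite L) {a : CStar L}
    (ha : ∀ m, a * proj m = proj m * a) : a ∈ cyclineSpan L := by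
  refine mem_of_spectral_mem hL hF ?_ fun i =>
    mem_cyclineSpan_of_homogeneous hL hF (spectral_mem hL hF i a) fun m =>
      spectral_commute hL hF (fun t => gauge_proj t m) (ha m) i
  exact Submodule.isClosed_topologicalClosure _

theorem pathAct_cycline_delta {m n : Mor L} (h : IsCycline m n) (z : InfPath L) :
    pathAct hL (gen m * star (gen n)) (delta z) = delta z ∨
      pathAct hL (gen m * star (gen n)) (delta z) = 0 := by
  by_cases hz : ∃ x, IsConcat n x z
  · obtain ⟨x, hx⟩ := hz
    obtain ⟨y, hy, hy'⟩ := h.2 x (hx.source_eq.symm.trans h.1.symm)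
    obtain rfl := hL.concat_unique hx hy'
    exact Or.inl (pathAct_monomial_delta hL hy hx)
  · exact Or.inr (pathAct_monomial_delta_eq_zero hL fun x _ hx => (hz ⟨x, hx⟩).elim)

theorem monomial_mul_mem_hasDegree (hL : IsKGraph L) (hF : IsRowFinite L) {a b c d : Mor L}
    (hab : a.source = b.source) (hcd : c.source = d.source) :
    gen a * star (gen b) * (gen c * star (gen d)) ∈ pairSpan (HasDegree
      (a.intDegree - b.intDegree + (c.intDegree - d.intDegree))) := by
  refine monomial_mul_mem hL hF hab hcd fun p q h1 h2 e => mem_pairSpan ⟨?_, ?_⟩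
  · exact (congrArg Mor.source e :)
  · have := congrArg Mor.intDegree e
    rw [Mor.intDegree_comp, Mor.intDegree_comp] at this
    rw [Mor.intDegree_comp, Mor.intDegree_comp, eq_sub_of_add_eq' this]
    abel

/-- Cycline monomials commute, because they act diagonally on the path representation, which is
faithful on the homogeneous combinations of monomials. -/
theorem cycline_commute (hL : IsKGraph L) (hF : IsRowFinite L)
    (hne : ∀ u : L, ∃ x : InfPath L, x.range = u) {a b c d : Mor L} (hab : IsCycline a b)
    (hcd : IsCycline c d) :
    gen a * star (gen b) * (gen c * star (gen d)) =
      gen c * star (gen d) * (gen a * star (gen b)) := by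
  have h1 := monomial_mul_mem_hasDegree hL hF hab.1 hcd.1
  have h2 := monomial_mul_mem_hasDegree hL hF hcd.1 hab.1
  rw [add_comm] at h2
  refine sub_eq_zero.1 (eq_zero_of_pathAct_eq_zero hL hF hne (Submodule.sub_mem _ h1 h2)
    fun z => ?_)
  rw [map_sub, map_mul _ (gen a * star (gen b)), map_mul _ (gen c * star (gen d))]
  generalize hA : pathAct hL (gen a * star (gen b)) = A
  generalize hB : pathAct hL (gen c * star (gen d)) = B
  change A (B (delta z)) - B (A (delta z)) = 0
  have h1 := pathAct_cycline_delta hL hab z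
  have h2 := pathAct_cycline_delta hL hcd z
  rw [hA] at h1
  rw [hB] at h2
  rcases h1 with h | h <;> rcases h2 with h' | h' <;> simp [h, h']

/-- The cycline subalgebra, as a `*`-algebra. -/
def cyclineAlgebra (hF : IsRowFinite L) : NonUnitalStarSubalgebra ℂ (CStar L) :=
  (pairAlgebra hL hF (isPairRel_isCycline hL)).topologicalClosure

theorem coe_cyclineAlgebra (hF : IsRowFinite L) :
    (cyclineAlgebra hL hF : Set (CStar L)) = cyclineSpan L := by
  rw [cyclineSpan_eq]
  rfl

theorem monomial_mem_cyclineAlgebra (hF : IsRowFinite L) {m n : Mor L} (h : IsCycline m n) :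
    gen m * star (gen n) ∈ cyclineAlgebra hL hF :=
  subset_closure (mem_pairSpan h)

theorem cyclineAlgebra_commute (hF : IsRowFinite L)
    (hne : ∀ u : L, ∃ x : InfPath L, x.range = u) :
    ∀ a ∈ cyclineAlgebra hL hF, ∀ b ∈ cyclineAlgebra hL hF, a * b = b * a := by
  have h1 : ∀ a ∈ pairSpan (IsCycline (L := L)), ∀ b ∈ pairSpan (IsCycline (L := L)),
      a * b = b * a := by
    intro a ha b hb
    refine Submodule.span_induction (p := fun a _ => a * b = b * a) ?_ ?_ ?_ ?_ ha
    · rintro _ ⟨m, n, h, rfl⟩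
      refine Submodule.span_induction (p := fun b _ => _ * b = b * _) ?_ ?_ ?_ ?_ hb
      · rintro _ ⟨m', n', h', rfl⟩
        exact cycline_commute hL hF hne h h'
      · simp
      · intro x y _ _ hx hy
        rw [mul_add, add_mul, hx, hy]
      · intro c x _ hx
        rw [mul_smul_comm, smul_mul_assoc, hx]
    · simp
    · intro x y _ _ hx hy
      rw [mul_add, add_mul, hx, hy]
    · intro c x _ hx
      rw [mul_smul_comm, smul_mul_assoc, hx]
  intro a ha b hb
  have h2 : ∀ b ∈ pairSpan (IsCycline (L := L)), a * b = b * a := fun b hb =>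
    closure_minimal (t := {a | a * b = b * a}) (fun a ha => h1 a ha b hb)
      (isClosed_eq (continuous_id.mul continuous_const) (continuous_const.mul continuous_id)) ha
  exact closure_minimal (t := {b | a * b = b * a}) h2
      (isClosed_eq (continuous_const.mul continuous_id) (continuous_id.mul continuous_const)) hb

theorem isMaximalAbelian_cyclineAlgebra [Finite L] (hF : IsRowFinite L)
    (hne : ∀ u : L, ∃ x : InfPath L, x.range = u) :
    CStarSub.IsMaximalAbelian (cyclineAlgebra hL hF) := by
  refine ⟨⟨NonUnitalStarSubalgebra.isClosed_topologicalClosure _,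
    cyclineAlgebra_commute hL hF hne⟩, fun C hC hle a ha => ?_⟩
  have := mem_cyclineSpan_of_commute hL hF fun m =>
    hC.2 a ha _ (hle (monomial_mem_cyclineAlgebra hL hF (hL.isCycline_refl m)))
  change a ∈ (cyclineAlgebra hL hF : Set (CStar L))
  rwa [coe_cyclineAlgebra]

end KGraph

namespace Example

open KGraph

/-! ### Invariants of the paths of the example -/

/-- The kinds of the edges at the vertices `u` and `w`. -/
inductive Letter
  | f
  | g
  | h

/-- A blue letter is written in front of a word, and a red one behind it. -/
def Colour.push : Colour → Letter → List Letter → List Letter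
  | .blue, l, w => l :: w
  | .red, l, w => w ++ [l]

theorem Colour.push_inj {c : Colour} {l l' : Letter} {w w' : List Letter}
    (h : c.push l w = c.push l' w') : l = l' ∧ w = w' := by
  cases c
  · exact List.cons_eq_cons.1 h
  · have := List.append_inj' h rfl
    exact ⟨by simpa using this.2, this.1⟩

theorem Colour.push_ne_nil (c : Colour) (l : Letter) (w : List Letter) : c.push l w ≠ [] := by
  cases c <;> simp [Colour.push]

/-- The effect of an edge on the pair of the number of edges `e` and the word of a path to which it
is appended. -/
def Edge.act : ∀ {x y : Vertex}, Edge x y → ℕ × List Letter → ℕ × List Letter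
  | _, _, .e _, s => (s.1 + 1, s.2)
  | _, _, .f c, s => (s.1, c.push .f s.2)
  | _, _, .g c, s => (s.1, c.push .g s.2)
  | _, _, .h c, s => (s.1, c.push .h s.2)
  | _, _, .alpha _, s => (s.1, [])
  | _, _, .beta _, s => (s.1, [])

/-- The effect of a path of the coloured graph, edge by edge. -/
def actPath {x : Vertex} : ∀ {y : Vertex}, Quiver.Path x y → ℕ × List Letter → ℕ × List Letter
  | _, .nil, s => s
  | _, .cons p a, s => Edge.act a (actPath p s)

theorem actPath_comp {x y : Vertex} (p : Quiver.Path x y) (s : ℕ × List Letter) :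
    ∀ {z : Vertex} (q : Quiver.Path y z), actPath (p.comp q) s = actPath q (actPath p s)
  | _, .nil => rfl
  | _, .cons q a => by
    simp only [Quiver.Path.comp_cons, actPath, actPath_comp p s q]

theorem actPath_rule {x y : Vertex} {p q : (show Paths Vertex from x) ⟶ y} (h : Rule p q)
    (s : ℕ × List Letter) : actPath p s = actPath q s := by
  cases h <;> rfl

/-- The effect of a path of the `2`-graph. Applied to `(0, [])`, it yields the number of edges `e`
of the path and the word of its remaining loops, in which the blue letters are read from right to
left and precede the red ones. -/
def act {X Y : Graph} (f : X ⟶ Y) (s : ℕ × List Letter) : ℕ × List Letter :=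
  Quot.lift (fun p : Quiver.Path (V := Vertex) X.as Y.as => actPath p s) (by
    rintro _ _ ⟨_, _, p, _, _, q, h⟩
    exact (actPath_comp p s _).trans ((actPath_comp _ _ q).trans
      ((congrArg _ (actPath_rule h _)).trans ((actPath_comp p s _).trans
        (actPath_comp _ _ q)).symm))) f

theorem act_id (X : Graph) (s : ℕ × List Letter) : act (𝟙 X) s = s := rfl

theorem act_comp {X Y Z : Graph} (f : X ⟶ Y) (g : Y ⟶ Z) (s : ℕ × List Letter) :
    act (f ≫ g) s = act g (act f s) := by
  induction f using Quot.ind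
  induction g using Quot.ind
  exact actPath_comp _ _ _

/-- The path of length one given by an edge, as a morphism. -/
def edgeHom {x y : Vertex} (a : Edge x y) : (⟨x⟩ : Graph) ⟶ ⟨y⟩ :=
  (CategoryTheory.Quotient.functor Rule).map (X := x) (Y := y) (Quiver.Hom.toPath (V := Vertex) a)

theorem act_edgeHom {x y : Vertex} (a : Edge x y) (s : ℕ × List Letter) :
    act (edgeHom a) s = a.act s := rfl

theorem degree_edgeHom {x y : Vertex} (a : Edge x y) :
    DegreeFunctor.degree (edgeHom a) = a.colour.degree := zero_add _

theorem degree_comp_edgeHom {x y z : Vertex} (f : (⟨x⟩ : Graph) ⟶ ⟨y⟩) (a : Edge y z) :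
    DegreeFunctor.degree (f ≫ edgeHom a) = DegreeFunctor.degree f + a.colour.degree :=
  (DegreeFunctor.degree_comp _ _).trans (congrArg _ (degree_edgeHom a))

theorem hom_induction {x : Vertex} {P : ∀ y, ((⟨x⟩ : Graph) ⟶ ⟨y⟩) → Prop} (h1 : P x (𝟙 _))
    (h2 : ∀ (y z : Vertex) (f : (⟨x⟩ : Graph) ⟶ ⟨y⟩) (a : Edge y z), P y f → P z (f ≫ edgeHom a))
    (y : Vertex) (f : (⟨x⟩ : Graph) ⟶ ⟨y⟩) : P y f := by
  have h {y : Vertex} (p : Quiver.Path (V := Vertex) x y) :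
      P y (Quot.mk _ p : (⟨x⟩ : Graph) ⟶ ⟨y⟩) := by
    induction p with
    | nil => exact h1
    | cons p a ih => exact h2 _ _ _ a ih
  exact Quot.ind h f

theorem edgeHom_comp_eq {x y y' z : Vertex} {a : Edge x y} {b : Edge y z} {a' : Edge x y'}
    {b' : Edge y' z} (h : Rule (two a b) (two a' b')) :
    edgeHom a ≫ edgeHom b = edgeHom a' ≫ edgeHom b' := CategoryTheory.Quotient.sound Rule h

/-- Every path of length two with two colours equals one with the colours in the opposite order. -/
theorem exists_swap {x y z : Vertex} (b : Edge x y) (a : Edge y z) (h : b.colour ≠ a.colour) :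
    ∃ (y' : Vertex) (a' : Edge x y') (b' : Edge y' z), a'.colour = a.colour ∧
      b'.colour = b.colour ∧ edgeHom b ≫ edgeHom a = edgeHom a' ≫ edgeHom b' := by
  cases b with
  | e c =>
    cases a with
    | e c' =>
      refine ⟨_, .e c', .e c, rfl, rfl, ?_⟩
      cases c <;> cases c'
      · exact (h rfl).elim
      · exact edgeHom_comp_eq .ee
      · exact (edgeHom_comp_eq .ee).symm
      · exact (h rfl).elim
    | alpha c' =>
      refine ⟨_, .e c', .alpha c, rfl, rfl, ?_⟩
      cases c <;> cases c'
      · exact (h rfl).elim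
      · exact edgeHom_comp_eq .ealpha
      · exact (edgeHom_comp_eq .ealpha).symm
      · exact (h rfl).elim
    | beta c' =>
      refine ⟨_, .e c', .beta c, rfl, rfl, ?_⟩
      cases c <;> cases c'
      · exact (h rfl).elim
      · exact edgeHom_comp_eq .ebeta
      · exact (edgeHom_comp_eq .ebeta).symm
      · exact (h rfl).elim
  | f c =>
    cases a with
    | f c' =>
      refine ⟨_, .f c', .f c, rfl, rfl, ?_⟩
      cases c <;> cases c'
      · exact (h rfl).elim
      · exact edgeHom_comp_eq .ff
      · exact (edgeHom_comp_eq .ff).symm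
      · exact (h rfl).elim
  | alpha c =>
    cases a with
    | f c' =>
      refine ⟨_, .alpha c', .f c, rfl, rfl, ?_⟩
      cases c <;> cases c'
      · exact (h rfl).elim
      · exact edgeHom_comp_eq .alphaf
      · exact (edgeHom_comp_eq .alphaf).symm
      · exact (h rfl).elim
  | beta c =>
    cases a with
    | g c' =>
      refine ⟨_, .beta c', .g c, rfl, rfl, ?_⟩
      cases c <;> cases c'
      · exact (h rfl).elim
      · exact edgeHom_comp_eq .betag
      · exact (edgeHom_comp_eq .betag).symm
      · exact (h rfl).elim
    | h c' =>
      refine ⟨_, .beta c', .h c, rfl, rfl, ?_⟩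
      cases c <;> cases c'
      · exact (h rfl).elim
      · exact edgeHom_comp_eq .betah
      · exact (edgeHom_comp_eq .betah).symm
      · exact (h rfl).elim
  | g c =>
    cases a with
    | g c' =>
      refine ⟨_, .g c', .g c, rfl, rfl, ?_⟩
      cases c <;> cases c'
      · exact (h rfl).elim
      · exact edgeHom_comp_eq .gg
      · exact (edgeHom_comp_eq .gg).symm
      · exact (h rfl).elim
    | h c' =>
      refine ⟨_, .h c', .g c, rfl, rfl, ?_⟩
      cases c <;> cases c'
      · exact (h rfl).elim
      · exact edgeHom_comp_eq .gh
      · exact (edgeHom_comp_eq .hg).symm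
      · exact (h rfl).elim
  | h c =>
    cases a with
    | g c' =>
      refine ⟨_, .g c', .h c, rfl, rfl, ?_⟩
      cases c <;> cases c'
      · exact (h rfl).elim
      · exact edgeHom_comp_eq .hg
      · exact (edgeHom_comp_eq .gh).symm
      · exact (h rfl).elim
    | h c' =>
      refine ⟨_, .h c', .h c, rfl, rfl, ?_⟩
      cases c <;> cases c'
      · exact (h rfl).elim
      · exact edgeHom_comp_eq .hh
      · exact (edgeHom_comp_eq .hh).symm
      · exact (h rfl).elim

theorem Colour.degree_le_of_ne {c c' : Colour} (h : c ≠ c') {n : Fin 2 → ℕ}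
    (hn : c.degree ≤ n + c'.degree) : c.degree ≤ n := by
  intro i
  have := hn i
  revert this
  cases c <;> cases c' <;> fin_cases i <;> first | exact (h rfl).elim | simp [Colour.degree]

theorem Colour.degree_ne_zero (c : Colour) : c.degree ≠ 0 := by
  cases c
  · exact fun h => one_ne_zero (congrFun h 0)
  · exact fun h => one_ne_zero (congrFun h 1)

theorem exists_colour_le {n : Fin 2 → ℕ} (hn : n ≠ 0) : ∃ c : Colour, c.degree ≤ n := by
  by_cases h : n 0 = 0
  · refine ⟨.red, Pi.le_def.2 (Fin.forall_fin_two.2 ⟨Nat.zero_le _, ?_⟩)⟩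
    refine Nat.one_le_iff_ne_zero.2 fun h' => hn (funext (Fin.forall_fin_two.2 ⟨h, h'⟩))
  · exact ⟨.blue, Pi.le_def.2 (Fin.forall_fin_two.2 ⟨Nat.one_le_iff_ne_zero.2 h, Nat.zero_le _⟩)⟩

/-- Every path with an edge of colour `c` can be written so that its last edge has colour `c`. -/
theorem exists_last_edge {x : Vertex} (c : Colour) (z : Vertex) (f : (⟨x⟩ : Graph) ⟶ ⟨z⟩) :
    c.degree ≤ DegreeFunctor.degree f →
    ∃ (y : Vertex) (f' : (⟨x⟩ : Graph) ⟶ ⟨y⟩) (a : Edge y z), a.colour = c ∧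
      f = f' ≫ edgeHom a := by
  refine hom_induction (P := fun z f => c.degree ≤ DegreeFunctor.degree f →
    ∃ (y : Vertex) (f' : (⟨x⟩ : Graph) ⟶ ⟨y⟩) (a : Edge y z), a.colour = c ∧
      f = f' ≫ edgeHom a) ?_ ?_ z f
  · intro h
    rw [DegreeFunctor.degree_id] at h
    exact (c.degree_ne_zero (le_antisymm h bot_le)).elim
  · intro y z f b ih h
    by_cases hb : b.colour = c
    · exact ⟨y, f, b, hb, rfl⟩
    rw [degree_comp_edgeHom] at h
    obtain ⟨y', f', a, rfl, rfl⟩ := ih (Colour.degree_le_of_ne (Ne.symm hb) h)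
    obtain ⟨y'', b', a', -, h1, h2⟩ := exists_swap a b (Ne.symm hb)
    exact ⟨y'', f' ≫ edgeHom b', a', h1, by rw [Category.assoc, h2, Category.assoc]⟩

theorem eq_eqToHom_of_degree_eq_zero {x z : Vertex} (f : (⟨x⟩ : Graph) ⟶ ⟨z⟩) :
    DegreeFunctor.degree f = 0 → ∃ h : x = z, f = eqToHom (congrArg _ h) := by
  refine hom_induction (P := fun z f => DegreeFunctor.degree f = 0 →
    ∃ h : x = z, f = eqToHom (congrArg (fun x : Vertex => (⟨x⟩ : Graph)) h)) ?_ ?_ z f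
  · exact fun _ => ⟨rfl, rfl⟩
  · intro y z f a _ h
    rw [degree_comp_edgeHom] at h
    exact (a.colour.degree_ne_zero (add_eq_zero.1 h).2).elim

theorem act_snd_of_source_v {x z : Vertex} (f : (⟨x⟩ : Graph) ⟶ ⟨z⟩) :
    z = .v → x = .v ∧ (act f (0, [])).2 = [] := by
  refine hom_induction (P := fun z f => z = .v → x = .v ∧ (act f (0, [])).2 = []) ?_ ?_ z f
  · exact fun h => ⟨h, rfl⟩
  · rintro y z f a ih rfl
    cases a
    obtain ⟨h1, h2⟩ := ih rfl
    exact ⟨h1, (congrArg Prod.snd (act_comp _ _ _)).trans h2⟩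

/-- The last edge of a path is determined by its colour and by the invariants of the path. -/
theorem last_edge_unique {x y y' z : Vertex} {f : (⟨x⟩ : Graph) ⟶ ⟨y⟩} {a : Edge y z}
    {f' : (⟨x⟩ : Graph) ⟶ ⟨y'⟩} {a' : Edge y' z} (hc : a.colour = a'.colour)
    (h : act (f ≫ edgeHom a) (0, []) = act (f' ≫ edgeHom a') (0, [])) :
    (⟨y, a⟩ : (y : Vertex) × Edge y z) = ⟨y', a'⟩ ∧ act f (0, []) = act f' (0, []) := by
  rw [act_comp, act_comp, act_edgeHom, act_edgeHom] at h
  have h1 := congrArg Prod.fst h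
  have h2 := congrArg Prod.snd h
  have key {c : Colour} {l l' : Letter} (e : c.push l (act f (0, [])).2 =
      c.push l' (act f' (0, [])).2) (e' : (act f (0, [])).1 = (act f' (0, [])).1) :
      l = l' ∧ act f (0, []) = act f' (0, []) :=
    ⟨(Colour.push_inj e).1, Prod.ext e' (Colour.push_inj e).2⟩
  cases a <;> cases a' <;> obtain rfl := hc
  case e.e =>
    exact ⟨rfl, Prod.ext (Nat.succ_injective h1) h2⟩
  case alpha.alpha | beta.beta =>
    exact ⟨rfl, Prod.ext h1 ((act_snd_of_source_v f rfl).2.trans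
      (act_snd_of_source_v f' rfl).2.symm)⟩
  case f.f | g.g | h.h => exact ⟨rfl, (key h2 h1).2⟩
  case g.h | h.g => cases (key h2 h1).1
  case f.alpha | g.beta | h.beta => exact (Colour.push_ne_nil _ _ _ h2).elim
  case alpha.f | beta.g | beta.h => exact (Colour.push_ne_nil _ _ _ h2.symm).elim

/-- A path is determined by its range, its source, its degree and its invariants. -/
theorem hom_ext {x z : Vertex} (f : (⟨x⟩ : Graph) ⟶ ⟨z⟩) :
    ∀ f' : (⟨x⟩ : Graph) ⟶ ⟨z⟩, DegreeFunctor.degree f = DegreeFunctor.degree f' →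
    act f (0, []) = act f' (0, []) → f = f' := by
  refine hom_induction (P := fun z f => ∀ f' : (⟨x⟩ : Graph) ⟶ ⟨z⟩,
    DegreeFunctor.degree f = DegreeFunctor.degree f' →
    act f (0, []) = act f' (0, []) → f = f') ?_ ?_ z f
  · intro f' hd _
    rw [DegreeFunctor.degree_id] at hd
    obtain ⟨_, h⟩ := eq_eqToHom_of_degree_eq_zero f' hd.symm
    exact h.symm
  · intro y z f a ih f' hd hs
    rw [degree_comp_edgeHom] at hd
    obtain ⟨y', f'', a', hc, rfl⟩ := exists_last_edge a.colour z f' (hd ▸ le_add_self)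
    obtain ⟨h1, h2⟩ := last_edge_unique hc.symm hs
    cases h1
    rw [degree_comp_edgeHom] at hd
    rw [ih f'' (add_right_cancel hd) h2]

/-! ### The unique factorisation property -/

theorem exists_factorisation {x : Vertex} (N : ℕ) : ∀ {z : Vertex} (f : (⟨x⟩ : Graph) ⟶ ⟨z⟩)
    (m n : Fin 2 → ℕ), n 0 + n 1 = N → DegreeFunctor.degree f = m + n →
    ∃ (y : Vertex) (g : (⟨x⟩ : Graph) ⟶ ⟨y⟩) (h : (⟨y⟩ : Graph) ⟶ ⟨z⟩),
      g ≫ h = f ∧ DegreeFunctor.degree g = m ∧ DegreeFunctor.degree h = n := by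
  induction N with
  | zero =>
    intro z f m n hn hd
    obtain rfl : n = 0 := funext (Fin.forall_fin_two.2 ⟨by simp; omega, by simp; omega⟩)
    exact ⟨z, f, 𝟙 _, Category.comp_id f, hd, DegreeFunctor.degree_id _⟩
  | succ N ih =>
    intro z f m n hn hd
    obtain ⟨c, hc⟩ := exists_colour_le (n := n) (by rintro rfl; simp at hn)
    obtain ⟨n, rfl⟩ : ∃ n', n = n' + c.degree := ⟨n - c.degree, (tsub_add_cancel_of_le hc).symm⟩
    obtain ⟨y, f', a, rfl, rfl⟩ := exists_last_edge c z f (by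
      rw [hd, ← add_assoc]; exact le_add_self)
    rw [degree_comp_edgeHom, ← add_assoc] at hd
    obtain ⟨y', g, h, rfl, h1, h2⟩ := ih f' m n (by
      simp only [Pi.add_apply] at hn
      generalize a.colour = c at hn
      cases c <;> simp [Colour.degree] at hn <;> omega) (add_right_cancel hd)
    exact ⟨y', g, h ≫ edgeHom a, (Category.assoc _ _ _).symm, h1, by
      rw [degree_comp_edgeHom, h2]⟩

theorem factorisation_unique {x y z : Vertex} (g : (⟨x⟩ : Graph) ⟶ ⟨y⟩)
    (h : (⟨y⟩ : Graph) ⟶ ⟨z⟩) : ∀ {y' : Vertex} (g' : (⟨x⟩ : Graph) ⟶ ⟨y'⟩)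
    (h' : (⟨y'⟩ : Graph) ⟶ ⟨z⟩), g ≫ h = g' ≫ h' →
    DegreeFunctor.degree g = DegreeFunctor.degree g' →
    DegreeFunctor.degree h = DegreeFunctor.degree h' →
    (⟨y, g, h⟩ : (y : Vertex) × ((⟨x⟩ : Graph) ⟶ ⟨y⟩) × ((⟨y⟩ : Graph) ⟶ ⟨z⟩)) =
      ⟨y', g', h'⟩ := by
  refine hom_induction (P := fun z h => ∀ {y' : Vertex} (g' : (⟨x⟩ : Graph) ⟶ ⟨y'⟩)
    (h' : (⟨y'⟩ : Graph) ⟶ ⟨z⟩), g ≫ h = g' ≫ h' →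
    DegreeFunctor.degree g = DegreeFunctor.degree g' →
    DegreeFunctor.degree h = DegreeFunctor.degree h' →
    (⟨y, g, h⟩ : (y : Vertex) × ((⟨x⟩ : Graph) ⟶ ⟨y⟩) × ((⟨y⟩ : Graph) ⟶ ⟨z⟩)) =
      ⟨y', g', h'⟩) ?_ ?_ z h
  · intro y' g' h' e _ h2
    rw [DegreeFunctor.degree_id] at h2
    obtain ⟨rfl, rfl⟩ := eq_eqToHom_of_degree_eq_zero h' h2.symm
    rw [eqToHom_refl, Category.comp_id, Category.comp_id] at e
    subst e
    rfl
  · intro t z h a ih y' g' h' e h1 h2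
    rw [degree_comp_edgeHom] at h2
    obtain ⟨t', h'', a', hc, rfl⟩ := exists_last_edge a.colour z h' (h2 ▸ le_add_self)
    rw [← Category.assoc, ← Category.assoc] at e
    obtain ⟨h3, h4⟩ := last_edge_unique hc.symm (congrArg (act · (0, [])) e)
    cases h3
    rw [degree_comp_edgeHom] at h2
    have h5 := add_right_cancel h2
    have h6 := hom_ext (g ≫ h) (g' ≫ h'')
      (by rw [DegreeFunctor.degree_comp, DegreeFunctor.degree_comp, h1, h5]) h4
    cases ih g' h'' h6 h1 h5
    rfl

theorem finite_edges (x : Vertex) : Finite ((y : Vertex) × Edge x y) := by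
  refine Set.finite_univ_iff.1 ?_
  cases x
  · refine (Set.toFinite {⟨_, .f .blue⟩, ⟨_, .f .red⟩}).subset ?_
    rintro ⟨y, a⟩ -
    cases a
    rename_i c
    cases c <;> simp
  · refine (Set.toFinite {⟨_, .e .blue⟩, ⟨_, .e .red⟩, ⟨_, .alpha .blue⟩, ⟨_, .alpha .red⟩,
      ⟨_, .beta .blue⟩, ⟨_, .beta .red⟩}).subset ?_
    rintro ⟨y, a⟩ -
    cases a <;> rename_i c <;> cases c <;> simp
  · refine (Set.toFinite {⟨_, .g .blue⟩, ⟨_, .g .red⟩, ⟨_, .h .blue⟩, ⟨_, .h .red⟩}).subset ?_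
    rintro ⟨y, a⟩ -
    cases a <;> rename_i c <;> cases c <;> simp

theorem finite_paths (x : Vertex) (N : ℕ) : ∀ n : Fin 2 → ℕ, n 0 + n 1 = N →
    {m : Mor Graph | m.range = ⟨x⟩ ∧ m.degree = n}.Finite := by
  induction N with
  | zero =>
    intro n hn
    refine (Set.finite_singleton (Mor.vertex (⟨x⟩ : Graph))).subset ?_
    rintro ⟨_, ⟨z⟩, f⟩ ⟨rfl, hd⟩
    obtain ⟨rfl, rfl⟩ := eq_eqToHom_of_degree_eq_zero f
      (hd.trans (funext (Fin.forall_fin_two.2 ⟨by simp; omega, by simp; omega⟩)))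
    rfl
  | succ N ih =>
    intro n hn
    obtain ⟨c, hc⟩ := exists_colour_le (n := n) (by rintro rfl; simp at hn)
    obtain ⟨n, rfl⟩ : ∃ n', n = n' + c.degree := ⟨n - c.degree, (tsub_add_cancel_of_le hc).symm⟩
    have h1 := ih n (by
      simp only [Pi.add_apply] at hn
      cases c <;> simp [Colour.degree] at hn <;> omega)
    have h2 (m : Mor Graph) : (Set.range fun t : (y : Vertex) × Edge m.source.as y =>
        (⟨m.range, ⟨t.1⟩, m.hom ≫ edgeHom t.2⟩ : Mor Graph)).Finite :=
      haveI := finite_edges m.source.as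
      Set.finite_range _
    refine (h1.biUnion fun m _ => h2 m).subset ?_
    rintro ⟨_, ⟨z⟩, f⟩ ⟨rfl, hd⟩
    change DegreeFunctor.degree f = _ at hd
    obtain ⟨y, f', a, rfl, rfl⟩ := exists_last_edge c z f (hd ▸ le_add_self)
    have hd' := (degree_comp_edgeHom f' a).symm.trans hd
    exact Set.mem_biUnion (x := ⟨⟨x⟩, ⟨y⟩, f'⟩) ⟨rfl, add_right_cancel hd'⟩ ⟨⟨z, a⟩, rfl⟩

theorem isRowFinite_graph : IsRowFinite Graph := fun u n => finite_paths u.as _ n rfl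

theorem finite_vertex : Finite Vertex := by
  refine Finite.of_injective (fun x : Vertex => match x with
    | .u => (0 : Fin 3)
    | .v => 1
    | .w => 2) ?_
  rintro (_ | _) (_ | _) h <;> first | rfl | simp at h

instance finite_graph : Finite Graph :=
  haveI : Finite (Paths Vertex) := finite_vertex
  Finite.of_injective (fun X : Graph => X.as) fun X Y h => by
    cases X
    cases Y
    cases h
    rfl

theorem isKGraph_graph : IsKGraph Graph where
  countable := by
    have h1 : (Set.univ : Set (Mor Graph)).Countable := by
      refine (Set.countable_iUnion fun u : Graph => Set.countable_iUnion fun n : Fin 2 → ℕ =>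
        (isRowFinite_graph u n).countable).mono fun m _ => ?_
      exact Set.mem_iUnion.2 ⟨m.range, Set.mem_iUnion.2 ⟨m.degree, rfl, rfl⟩⟩
    exact Set.countable_univ_iff.1 h1
  factorisation {X Z} f m n hd := by
    obtain ⟨y, g, h, h1, h2, h3⟩ := exists_factorisation (x := X.as) (z := Z.as) _ f m n rfl hd
    refine ⟨⟨⟨y⟩, g, h⟩, ⟨h1, h2, h3⟩, ?_⟩
    rintro ⟨⟨y'⟩, g', h'⟩ ⟨h1', h2', h3'⟩
    cases factorisation_unique (x := X.as) (z := Z.as) g h g' h' (h1.trans h1'.symm)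
      (h2.trans h2'.symm) (h3.trans h3'.symm)
    rfl

theorem bijOn_ofEdge (c : Colour) : Set.BijOn ofEdge {t | t.2.2.colour = c}
    {m : Mor Graph | m.degree = c.degree} := by
  refine ⟨?_, ?_, ?_⟩
  · rintro ⟨x, y, a⟩ rfl
    exact degree_edgeHom a
  · rintro ⟨x, y, a⟩ ha ⟨x', y', a'⟩ ha' h
    injection h with h1 h2 h3
    cases h1
    cases h2
    have h4 : 𝟙 _ ≫ edgeHom a = 𝟙 _ ≫ edgeHom a' := by
      rw [Category.id_comp, Category.id_comp]
      exact eq_of_heq h3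
    obtain ⟨h5, -⟩ := last_edge_unique (ha.trans ha'.symm) (congrArg (act · (0, [])) h4)
    cases h5
    rfl
  · rintro ⟨⟨x⟩, ⟨z⟩, f⟩ hd
    change DegreeFunctor.degree f = _ at hd
    obtain ⟨y, f', a, rfl, rfl⟩ := exists_last_edge c z f hd.ge
    have hd' := (degree_comp_edgeHom f' a).symm.trans hd
    obtain ⟨rfl, rfl⟩ := eq_eqToHom_of_degree_eq_zero f' (add_eq_right.1 hd')
    exact ⟨⟨x, z, a⟩, rfl, congrArg (Mor.mk _ _) (Category.id_comp _).symm⟩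

/-! ### The loops at the vertices -/

/-- A loop of the given colour at a vertex. -/
def loop : (x : Vertex) → Colour → Edge x x
  | .u, c => .f c
  | .v, c => .e c
  | .w, c => .g c

/-- The loop of the given colour, in the monoid of paths from a vertex to itself. -/
def loopEnd (x : Vertex) (c : Colour) : End (⟨x⟩ : Graph) := edgeHom (loop x c)

theorem loopEnd_commute (x : Vertex) : Commute (loopEnd x .blue) (loopEnd x .red) := by
  cases x
  · exact (edgeHom_comp_eq .ff).symm
  · exact (edgeHom_comp_eq .ee).symm
  · exact (edgeHom_comp_eq .gg).symm

/-- The path of degree `n` from a vertex to itself along the chosen loops. -/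
def loopHom (x : Vertex) (n : Fin 2 → ℕ) : (⟨x⟩ : Graph) ⟶ ⟨x⟩ :=
  (loopEnd x .blue ^ n 0 * loopEnd x .red ^ n 1 : End (⟨x⟩ : Graph))

theorem loopHom_zero (x : Vertex) : loopHom x 0 = 𝟙 _ := by
  simp [loopHom]

theorem loopHom_comp (x : Vertex) (m n : Fin 2 → ℕ) :
    loopHom x m ≫ loopHom x n = loopHom x (m + n) := by
  have h := loopEnd_commute x
  change loopEnd x .blue ^ n 0 * loopEnd x .red ^ n 1 *
    (loopEnd x .blue ^ m 0 * loopEnd x .red ^ m 1) = _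
  rw [(h.pow_pow (m 0) (n 1)).symm.mul_mul_mul_comm, ← pow_add, ← pow_add, add_comm, add_comm (n 1)]
  rfl

theorem degree_loopEnd_pow (x : Vertex) (c : Colour) (n : ℕ) :
    DegreeFunctor.degree (show (⟨x⟩ : Graph) ⟶ ⟨x⟩ from loopEnd x c ^ n) = n • c.degree := by
  induction n with
  | zero => rw [zero_smul]; exact DegreeFunctor.degree_id _
  | succ n ih =>
    rw [pow_succ, succ_nsmul', ← ih]
    refine (DegreeFunctor.degree_comp (L := Graph) _ _).trans ?_
    congr 1
    refine (degree_edgeHom _).trans ?_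
    cases x <;> rfl

theorem degree_loopHom (x : Vertex) (n : Fin 2 → ℕ) : DegreeFunctor.degree (loopHom x n) = n := by
  refine (DegreeFunctor.degree_comp (L := Graph) _ _).trans ?_
  refine (congrArg₂ _ (degree_loopEnd_pow x .red _) (degree_loopEnd_pow x .blue _)).trans ?_
  funext i
  fin_cases i <;> simp [Colour.degree]

theorem hasNoSources_graph : HasNoSources Graph := fun u n =>
  ⟨⟨u, u, loopHom u.as n⟩, rfl, degree_loopHom u.as n⟩

/-- The infinite path along the chosen loops at a vertex. -/
def loopPath (x : Vertex) : InfPath Graph where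
  vertex _ := ⟨x⟩
  seg m n _ := loopHom x (n - m)
  seg_self m := by rw [tsub_self, loopHom_zero]
  seg_comp l m n h h' := by rw [loopHom_comp, add_comm, tsub_add_tsub_cancel h' h]
  degree_seg m n h := by rw [degree_loopHom, add_tsub_cancel_of_le h]

theorem exists_infPath_range (u : Graph) : ∃ x : InfPath Graph, x.range = u :=
  ⟨loopPath u.as, rfl⟩

end Example

namespace Example

open KGraph

/-! ### Paths by their sources and ranges -/

theorem act_comp_mor (a b : Mor Graph) (h) (s : ℕ × List Letter) :
    act (a.comp b h).hom s = act b.hom (act a.hom s) := by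
  obtain ⟨_, _, f⟩ := a
  obtain ⟨_, _, g⟩ := b
  cases h
  rw [Mor.comp_mk]
  exact act_comp f g s

theorem mor_ext {a b : Mor Graph} (hr : a.range = b.range) (hs : a.source = b.source)
    (hd : a.degree = b.degree) (h : act a.hom (0, []) = act b.hom (0, [])) : a = b := by
  obtain ⟨X, Z, f⟩ := a
  obtain ⟨X', Z', f'⟩ := b
  cases hr
  cases hs
  exact congrArg (Mor.mk _ _) (hom_ext (x := X.as) (z := Z.as) f f' hd h)

/-- A path with source `v` consists of edges `e`. -/
theorem act_of_source_v {x z : Vertex} (f : (⟨x⟩ : Graph) ⟶ ⟨z⟩) : z = .v → x = .v ∧ ∀ s,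
    act f s = (s.1 + (DegreeFunctor.degree f 0 + DegreeFunctor.degree f 1), s.2) := by
  refine hom_induction (P := fun z f => z = .v → x = .v ∧ ∀ s,
    act f s = (s.1 + (DegreeFunctor.degree f 0 + DegreeFunctor.degree f 1), s.2)) ?_ ?_ z f
  · refine fun h => ⟨h, fun s => ?_⟩
    rw [DegreeFunctor.degree_id]
    rfl
  · rintro y z f a ih rfl
    cases a
    rename_i c
    obtain ⟨h1, h2⟩ := ih rfl
    refine ⟨h1, fun s => ?_⟩
    rw [act_comp, h2, act_edgeHom, degree_comp_edgeHom]
    cases c <;> simp [Edge.act, Edge.colour, Colour.degree] <;> omega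

/-- A path with range `u` consists of edges `f`. -/
theorem act_of_range_u {x z : Vertex} (f : (⟨x⟩ : Graph) ⟶ ⟨z⟩) (hx : x = .u) : z = .u ∧ ∀ s,
    act f s = (s.1, List.replicate (DegreeFunctor.degree f 0) .f ++ s.2 ++
      List.replicate (DegreeFunctor.degree f 1) .f) := by
  refine hom_induction (P := fun z f => z = .u ∧ ∀ s,
    act f s = (s.1, List.replicate (DegreeFunctor.degree f 0) .f ++ s.2 ++
      List.replicate (DegreeFunctor.degree f 1) .f)) ?_ ?_ z f
  · refine ⟨hx, fun s => ?_⟩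
    rw [DegreeFunctor.degree_id]
    simp [act_id]
  · rintro y z f a ⟨rfl, ih⟩
    cases a
    rename_i c
    refine ⟨rfl, fun s => ?_⟩
    rw [act_comp, ih, act_edgeHom, degree_comp_edgeHom]
    cases c
    · simp [Edge.act, Edge.colour, Colour.degree, Colour.push, List.replicate_succ]
    · simp [Edge.act, Edge.colour, Colour.degree, Colour.push, List.replicate_succ',
        -List.append_cancel_left_eq]

/-- A path with range `w` consists of edges `g` and `h`; its blue edges are written in front of
a word, and its red edges behind it. -/
theorem act_of_range_w {x z : Vertex} (f : (⟨x⟩ : Graph) ⟶ ⟨z⟩) (hx : x = .w) : z = .w ∧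
    ∃ l r : List Letter, l.length = DegreeFunctor.degree f 0 ∧
      ∀ s, act f s = (s.1, l ++ s.2 ++ r) := by
  refine hom_induction (P := fun z f => z = .w ∧
    ∃ l r : List Letter, l.length = DegreeFunctor.degree f 0 ∧
      ∀ s, act f s = (s.1, l ++ s.2 ++ r)) ?_ ?_ z f
  · refine ⟨hx, [], [], ?_, fun s => ?_⟩
    · rw [DegreeFunctor.degree_id]
      rfl
    · simp [act_id]
  · rintro y z f a ⟨rfl, l, r, hl, ih⟩
    have key (c : Colour) (t : Letter) : ∃ l' r' : List Letter,
        l'.length = (DegreeFunctor.degree f + c.degree) 0 ∧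
        ∀ w : List Letter, c.push t (l ++ w ++ r) = l' ++ w ++ r' := by
      cases c
      · exact ⟨t :: l, r, by simp [hl, Colour.degree], fun w => rfl⟩
      · exact ⟨l, r ++ [t], by simp [hl, Colour.degree], fun w => by simp [Colour.push]⟩
    cases a <;> rename_i c <;> refine ⟨rfl, ?_⟩
    · obtain ⟨l', r', h1, h2⟩ := key c .g
      refine ⟨l', r', by rw [degree_comp_edgeHom]; exact h1, fun s => ?_⟩
      rw [act_comp, ih, act_edgeHom, ← h2]
      rfl
    · obtain ⟨l', r', h1, h2⟩ := key c .h
      refine ⟨l', r', by rw [degree_comp_edgeHom]; exact h1, fun s => ?_⟩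
      rw [act_comp, ih, act_edgeHom, ← h2]
      rfl

/-- The path of degree `n` from `v` to `v`. -/
def ePath (n : Fin 2 → ℕ) : Mor Graph := ⟨⟨.v⟩, ⟨.v⟩, loopHom .v n⟩

theorem degree_ePath (n : Fin 2 → ℕ) : (ePath n).degree = n := degree_loopHom .v n

theorem act_ePath (n : Fin 2 → ℕ) (s : ℕ × List Letter) :
    act (ePath n).hom s = (s.1 + (n 0 + n 1), s.2) := by
  have := (act_of_source_v (loopHom .v n) rfl).2 s
  rwa [degree_loopHom] at this

theorem ePath_comp (m n : Fin 2 → ℕ) : (ePath m).comp (ePath n) rfl = ePath (m + n) :=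
  (Mor.comp_mk _ _ _).trans (congrArg (Mor.mk _ _) (loopHom_comp .v m n))

theorem exists_isConcat_of_add {m n : Fin 2 → ℕ} {x y : InfPath Graph}
    (h : IsConcat (ePath (m + n)) x y) : ∃ z, IsConcat (ePath n) x z ∧ IsConcat (ePath m) z y := by
  rw [← ePath_comp] at h
  exact isKGraph_graph.concat_comp_iff.1 h

theorem eq_ePath {m : Mor Graph} (h : m.source = ⟨.v⟩) : m = ePath m.degree := by
  obtain ⟨⟨x⟩, _, f⟩ := m
  cases h
  obtain ⟨rfl, h2⟩ := act_of_source_v f rfl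
  refine mor_ext rfl rfl (degree_ePath _).symm ?_
  rw [act_ePath]
  exact h2 _

/-- The path from `u` to `v` that ends in a blue edge `α` behind a path of degree `n` at `v`. -/
def alphaPath (n : Fin 2 → ℕ) : Mor Graph :=
  (ePath n).comp (ofEdge ⟨.v, .u, .alpha .blue⟩) rfl

theorem degree_alphaPath (n : Fin 2 → ℕ) : (alphaPath n).degree = n + ![1, 0] :=
  (Mor.degree_comp _ _ _).trans (congrArg₂ _ (degree_ePath n) (degree_edgeHom _))

theorem act_alphaPath (n : Fin 2 → ℕ) : act (alphaPath n).hom (0, []) = (n 0 + n 1, []) := by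
  refine (act_comp_mor _ _ _ _).trans ?_
  rw [act_ePath, zero_add]
  rfl

theorem ePath_comp_alphaPath (m n : Fin 2 → ℕ) :
    (ePath m).comp (alphaPath n) rfl = alphaPath (m + n) := by
  refine (Mor.comp_assoc _ _ _ rfl rfl).symm.trans ?_
  unfold alphaPath
  congr 1
  exact ePath_comp m n

theorem gen_alphaPath_add (m n : Fin 2 → ℕ) :
    gen (alphaPath (m + n)) = gen (ePath m) * gen (alphaPath n) := by
  rw [← ePath_comp_alphaPath]
  exact gen_comp _ _ _

theorem star_gen_mul_gen_alphaPath_add (m n : Fin 2 → ℕ) :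
    star (gen (ePath m)) * gen (alphaPath (m + n)) = gen (alphaPath n) := by
  rw [← ePath_comp_alphaPath]
  exact star_gen_mul_gen_comp _ _ _

/-- Paths from `u` to `v` with the same number of edges `e` form a cycline pair. -/
theorem isCycline_alphaPath {m n : Fin 2 → ℕ} (h : m 0 + m 1 = n 0 + n 1) :
    IsCycline (alphaPath m) (alphaPath n) := by
  refine ⟨rfl, fun x hx => ?_⟩
  obtain ⟨y, hy⟩ := isKGraph_graph.exists_concat (m := alphaPath m) (x := x) hx.symm
  obtain ⟨y', hy'⟩ := isKGraph_graph.exists_concat (m := alphaPath n) (x := x) hx.symm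
  suffices h : y = y' from ⟨y, hy, h ▸ hy'⟩
  refine isKGraph_graph.infPath_ext fun N => ⟨N + (m + n + ![1, 0]), le_self_add, ?_⟩
  have e1 : (alphaPath m).degree + (N + n) = N + (m + n + ![1, 0]) := by
    rw [degree_alphaPath]; abel
  have e2 : (alphaPath n).degree + (N + m) = N + (m + n + ![1, 0]) := by
    rw [degree_alphaPath]; abel
  -- the segments of `x` have source `u` and words that depend on their degree only
  have key (p : Fin 2 → ℕ) : (x.initial p).source = ⟨.u⟩ ∧ ∀ s,
      act (x.initial p).hom s = (s.1, List.replicate (p 0) .f ++ s.2 ++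
        List.replicate (p 1) .f) := by
    have h1 : (x.initial p).range = ⟨.u⟩ := hx
    have h2 := x.degree_initial p
    generalize x.initial p = a at h1 h2
    obtain ⟨_, ⟨z⟩, f⟩ := a
    cases h1
    obtain ⟨rfl, h3⟩ := act_of_range_u f rfl
    subst h2
    exact ⟨rfl, h3⟩
  have h1 := hy.initial_add (N + n)
  have h2 := hy'.initial_add (N + m)
  refine (e1 ▸ h1).trans (Eq.trans ?_ (e2 ▸ h2).symm)
  refine mor_ext rfl ((key _).1.trans (key _).1.symm) ?_ ?_
  · refine (Mor.degree_comp _ _ _).trans (Eq.trans ?_ (Mor.degree_comp _ _ _).symm)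
    rw [InfPath.degree_initial, InfPath.degree_initial, e1, e2]
  · refine (act_comp_mor _ _ _ _).trans (Eq.trans ?_ (act_comp_mor _ _ _ _).symm)
    rw [act_alphaPath, act_alphaPath, (key _).2, (key _).2]
    refine Prod.ext h ?_
    simp only [List.append_nil, List.replicate_append_replicate, Pi.add_apply]
    congr 1
    omega

/-- A path whose source is not `v` is an initial segment of only finitely many of the paths
`e ⋯ e α`: to its end it passes a fixed number of edges `e`, and after it none. -/
theorem eventually_not_isPrefix_alphaPath {m : Mor Graph} (h : m.source ≠ ⟨.v⟩) :
    ∀ᶠ j : ℕ in atTop, ¬ m.IsPrefix (alphaPath ![j, j + 1]) := by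
  filter_upwards [eventually_gt_atTop (act m.hom (0, [])).1] with j hj
  rintro ⟨b, hb, e⟩
  have h1 : b.source = ⟨.u⟩ := congrArg Mor.source e
  have h2 : act b.hom (act m.hom (0, [])) = (j + (j + 1), []) := by
    rw [← act_comp_mor m b hb, e]
    exact act_alphaPath _
  rw [hb] at h
  obtain ⟨⟨x⟩, _, f⟩ := b
  cases h1
  cases x with
  | u =>
    have h3 := congrArg Prod.fst (((act_of_range_u f rfl).2 _).symm.trans h2)
    simp only at h3
    omega
  | v => exact h rfl
  | w => cases (act_of_range_w f rfl).1

/-! ### Paths that distinguish the degrees of the paths at `v` -/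

/-- The word `h g^N` cannot occur at two positions that differ by at most `N`, because `h` would
have to match a `g`. -/
theorem word_ne {N : ℕ} {l r l' r' : List Letter} (h1 : l.length < l'.length)
    (h2 : l'.length ≤ l.length + N) :
    l ++ (Letter.h :: List.replicate N .g) ++ r ≠
      l' ++ (Letter.h :: List.replicate N .g) ++ r' := by
  intro e
  have h3 := congrArg (fun w => w[l'.length]?) e
  obtain ⟨t, ht⟩ := Nat.exists_eq_add_of_lt h1
  have h4 : t < N := by omega
  simp only [List.append_assoc, List.getElem?_append_right h1.le,
    List.getElem?_append_right le_rfl, Nat.sub_self, List.cons_append,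
    List.getElem?_cons_zero] at h3
  rw [ht, show l.length + t + 1 - l.length = t + 1 by omega, List.getElem?_cons_succ,
    List.getElem?_append_left (by simpa using h4), List.getElem?_replicate, if_pos h4] at h3
  cases h3

/-- The path `β h g^N` from `w` to `v` with the colours blue, blue, and red. -/
def betaHom : ℕ → ((⟨.v⟩ : Graph) ⟶ ⟨.w⟩)
  | 0 => edgeHom (.beta .blue) ≫ edgeHom (.h .blue)
  | N + 1 => betaHom N ≫ edgeHom (.g .red)

theorem act_betaHom (N : ℕ) (i : ℕ) :
    act (betaHom N) (i, []) = (i, Letter.h :: List.replicate N .g) := by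
  induction N with
  | zero => exact (act_comp _ _ _).trans (congrArg _ (act_edgeHom _ _))
  | succ N ih =>
    refine (act_comp _ _ _).trans ?_
    rw [ih, act_edgeHom, List.replicate_succ']
    rfl

/-- The paths at `v` of different degrees are told apart by an infinite path that begins with
`β h g^N`. Its letter `h` occurs behind `d - p 0` letters in an initial segment of blue degree
`d + 2` of its concatenation with `ePath p`, and for `p 0 ≠ q 0` these positions differ. -/
theorem exists_infPath_not_isConcat {p q : Fin 2 → ℕ} (hpq : p ≠ q) :
    ∃ x : InfPath Graph, x.range = ⟨.v⟩ ∧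
      ∀ y, IsConcat (ePath p) x y → ¬ IsConcat (ePath q) x y := by
  let b : Mor Graph := ⟨⟨.v⟩, ⟨.w⟩, betaHom (p 0 + q 0)⟩
  obtain ⟨x, hx⟩ := isKGraph_graph.exists_concat (m := b) (x := loopPath .w) rfl
  refine ⟨x, hx.range_eq, fun y hp hq => ?_⟩
  -- the invariants of the initial segment of `y` of degree `p + d(b) + n`
  have key {p' : Fin 2 → ℕ} (h : IsConcat (ePath p') x y) (n T : Fin 2 → ℕ)
      (hT : p' + (b.degree + n) = T) : ∃ l r : List Letter, l.length = n 0 ∧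
      act (y.initial T).hom (0, []) =
        (p' 0 + p' 1, l ++ (Letter.h :: List.replicate (p 0 + q 0) .g) ++ r) := by
    obtain ⟨-, l, r, h1, h2⟩ := act_of_range_w ((loopPath .w).initial n).hom rfl
    have h3 : DegreeFunctor.degree ((loopPath .w).initial n).hom = n := InfPath.degree_initial _ n
    refine ⟨l, r, h1.trans (congrFun h3 0), ?_⟩
    have h4 := h.initial_add (b.degree + n)
    rw [degree_ePath, hT] at h4
    rw [h4]
    refine (act_comp_mor _ _ _ _).trans ?_
    rw [act_ePath, hx.initial_add]
    refine (act_comp_mor _ _ _ _).trans ?_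
    refine (h2 _).trans ?_
    rw [zero_add, act_betaHom]
  obtain ⟨l, r, h1, h2⟩ := key hp q _ rfl
  obtain ⟨l', r', h1', h2'⟩ := key hq p (p + (b.degree + q)) (by abel)
  have h3 := h2.symm.trans h2'
  have h4 := congrArg Prod.fst h3
  have h5 := congrArg Prod.snd h3
  simp only at h4 h5
  rcases lt_trichotomy (p 0) (q 0) with h | h | h
  · exact word_ne (by omega) (by omega) h5.symm
  · exact hpq (funext (Fin.forall_fin_two.2 ⟨h, by omega⟩))
  · exact word_ne (by omega) (by omega) h5

/-- A cycline pair with source `v` is trivial. -/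
theorem eq_of_isCycline {m n : Mor Graph} (h : IsCycline m n) (hn : n.source = ⟨.v⟩) : m = n := by
  have hm := h.1.trans hn
  rw [eq_ePath hm, eq_ePath hn] at h ⊢
  by_contra hne
  obtain ⟨x, hx, hx'⟩ := exists_infPath_not_isConcat (p := m.degree) (q := n.degree)
    fun e => hne (congrArg ePath e)
  obtain ⟨y, h1, h2⟩ := h.2 x hx
  exact hx' y h1 h2

/-! ### The isotropy -/

/-- The arrow `(m x, d(m) - d(n), n x)`. -/
def arrowOf {m n : Mor Graph} {x y z : InfPath Graph} (h : IsConcat m x y) (h' : IsConcat n x z) :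
    PathGroupoid Graph :=
  ⟨y, z, ⟨fun i => m.degree i - n.degree i, m.degree, n.degree, h.2.trans h'.2.symm, fun _ => rfl⟩⟩

theorem isConcat_loopPath (n : Fin 2 → ℕ) : IsConcat (ePath n) (loopPath .v) (loopPath .v) := by
  have h : (loopPath .v).initial n = ePath n := rfl
  have h' := IsConcat.of_initial (m := ePath n) (y := loopPath .v) (by rw [degree_ePath, h])
  convert h' using 1
  refine InfPath.ext rfl (heq_of_eq ?_)
  funext a b hab
  exact congrArg (loopHom .v) (add_tsub_add_eq_tsub_right b _ a).symm

/-- The arrow at `e e e ⋯` with degree `(1, -1)`. -/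
def arrowAtV : PathGroupoid Graph :=
  arrowOf (isConcat_loopPath ![1, 0]) (isConcat_loopPath ![0, 1])

theorem tendsto_arrowAtV {γ : ℕ → PathGroupoid Graph} (hγ : ∀ j : ℕ, γ j ∈
    PathGroupoid.cylinder (ePath ![j + 1, j]) (ePath ![j, j + 1])) :
    Tendsto γ atTop (𝓝 arrowAtV) := by
  refine TopologicalSpace.tendsto_nhds_generateFrom_iff.2 ?_
  rintro _ ⟨m, n, -, rfl⟩ ⟨x, hm, hn, hd⟩
  have em := eq_ePath (m := m) (congrArg Mor.source hm.1).symm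
  have en := eq_ePath (m := n) (congrArg Mor.source hn.1).symm
  -- As `d(m) - d(n) = (1, -1)`, both `m` and `n` are extended by the same path `ePath r`.
  have hd0 := hd 0
  have hd1 := hd 1
  simp only [arrowAtV, arrowOf, degree_ePath] at hd0 hd1
  simp at hd0 hd1
  refine mem_atTop_sets.2 ⟨m.degree 0 + m.degree 1, fun j hj => ?_⟩
  obtain ⟨z, h1, h2, h3⟩ := hγ j
  set r : Fin 2 → ℕ := ![j + 1 - m.degree 0, j - m.degree 1]
  have e1 : ![j + 1, j] = m.degree + r := by
    refine funext (Fin.forall_fin_two.2 ⟨?_, ?_⟩) <;> simp [r] <;> omega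
  have e2 : ![j, j + 1] = n.degree + r := by
    refine funext (Fin.forall_fin_two.2 ⟨?_, ?_⟩) <;> simp [r] <;> omega
  rw [e1] at h1
  rw [e2] at h2
  obtain ⟨t, h4, h5⟩ := exists_isConcat_of_add h1
  obtain ⟨t', h4', h5'⟩ := exists_isConcat_of_add h2
  rw [← em] at h5
  rw [← en] at h5'
  obtain rfl := isKGraph_graph.concat_unique h4 h4'
  refine ⟨t, h5, h5', fun i => (h3 i).trans ?_⟩
  rw [degree_ePath, degree_ePath, e1, e2]
  simp

/-- An arrow at `e e e ⋯` is a limit of isotropy arrows whose ends pass through `α`, and a limit of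
arrows outside of the isotropy whose ends pass through `β`. -/
theorem not_isClosed_interior_isotropy : ¬ IsClosed (interior (isotropy Graph)) := by
  intro hcl
  have hα (j : ℕ) : ∃ γ, γ ∈ interior (isotropy Graph) ∧
      γ ∈ PathGroupoid.cylinder (ePath ![j + 1, j]) (ePath ![j, j + 1]) := by
    have hc : IsCycline (alphaPath ![j + 1, j]) (alphaPath ![j, j + 1]) :=
      isCycline_alphaPath (add_comm (j + 1) j)
    obtain ⟨y, h1, h2⟩ := hc.2 (loopPath .u) rfl
    refine ⟨arrowOf h1 h2, ?_, ?_⟩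
    · refine mem_interior.2 ⟨PathGroupoid.cylinder (alphaPath ![j + 1, j]) (alphaPath ![j, j + 1]),
        ?_, TopologicalSpace.isOpen_generateFrom_of_mem ⟨_, _, hc.1, rfl⟩,
        ⟨_, h1, h2, fun i => rfl⟩⟩
      rintro γ ⟨x, h3, h4, -⟩
      obtain ⟨y', h5, h6⟩ := hc.2 x h3.source_eq.symm
      exact (isKGraph_graph.concat_unique h3 h5).trans (isKGraph_graph.concat_unique h6 h4)
    · obtain ⟨t, h4, h5⟩ := isKGraph_graph.concat_comp_iff.1 h1
      obtain ⟨t', h4', h5'⟩ := isKGraph_graph.concat_comp_iff.1 h2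
      obtain rfl := isKGraph_graph.concat_unique h4 h4'
      refine ⟨t, h5, h5', fun i => ?_⟩
      simp only [arrowOf, degree_alphaPath, degree_ePath, Pi.add_apply]
      push_cast
      ring
  have hβ (j : ℕ) : ∃ γ, γ ∉ isotropy Graph ∧
      γ ∈ PathGroupoid.cylinder (ePath ![j + 1, j]) (ePath ![j, j + 1]) := by
    obtain ⟨x, hx, hne⟩ := exists_infPath_not_isConcat (p := ![j + 1, j]) (q := ![j, j + 1])
      fun e => by simpa using congrFun e 0
    obtain ⟨y, h1⟩ := isKGraph_graph.exists_concat (m := ePath ![j + 1, j]) hx.symm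
    obtain ⟨z, h2⟩ := isKGraph_graph.exists_concat (m := ePath ![j, j + 1]) hx.symm
    exact ⟨arrowOf h1 h2, fun e : y = z => hne y h1 (e ▸ h2), x, h1, h2, fun i => rfl⟩
  choose γ h1 h2 using hα
  choose η h3 h4 using hβ
  have h5 : arrowAtV ∈ interior (isotropy Graph) :=
    hcl.mem_of_tendsto (tendsto_arrowAtV h2) (Eventually.of_forall h1)
  obtain ⟨j, hj⟩ := ((tendsto_arrowAtV h4).eventually (isOpen_interior.mem_nhds h5)).exists
  exact h3 j (interior_subset hj)

/-! ### Conditional expectations -/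

/-- On the range projections of the paths `e ⋯ e α`, every element of the cycline algebra is
approximately scalar. -/
theorem exists_eventually_mul_proj_eq {m : CStar Graph} (hm : m ∈ pairSpan (L := Graph) IsCycline) :
    ∃ c : ℂ, ∀ᶠ j : ℕ in atTop,
      m * proj (alphaPath ![j, j + 1]) = c • proj (alphaPath ![j, j + 1]) := by
  induction hm using Submodule.span_induction with
  | mem a ha =>
    obtain ⟨m, n, hmn, rfl⟩ := ha
    by_cases hn : n.source = ⟨.v⟩
    · obtain rfl := eq_of_isCycline hmn hn
      refine ⟨1, ?_⟩
      filter_upwards [eventually_ge_atTop (m.degree 0 + m.degree 1)] with j hj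
      set r : Fin 2 → ℕ := ![j - m.degree 0, j + 1 - m.degree 1]
      have e : ![j, j + 1] = m.degree + r := by
        refine funext (Fin.forall_fin_two.2 ⟨?_, ?_⟩) <;> simp [r] <;> omega
      have h1 : gen m * star (gen m) * gen (alphaPath ![j, j + 1]) =
          gen (alphaPath ![j, j + 1]) := by
        rw [e, eq_ePath hn, degree_ePath, mul_assoc, star_gen_mul_gen_alphaPath_add,
          gen_alphaPath_add]
      rw [proj, ← mul_assoc, h1, one_smul]
    · refine ⟨0, ?_⟩
      filter_upwards [eventually_not_isPrefix_alphaPath hn,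
        eventually_ge_atTop (n.degree 0 + n.degree 1)] with j h1 hj
      rw [zero_smul, proj, mul_assoc, ← mul_assoc (star _),
        star_gen_mul_gen_of_not_isPrefix isKGraph_graph isRowFinite_graph ?_ h1, zero_mul, mul_zero]
      rw [degree_alphaPath]
      refine Pi.le_def.2 (Fin.forall_fin_two.2 ⟨?_, ?_⟩) <;> simp <;> omega
  | zero => exact ⟨0, Eventually.of_forall fun j => by rw [zero_mul, zero_smul]⟩
  | add a b _ _ ha hb =>
    obtain ⟨c, hc⟩ := ha
    obtain ⟨d, hd⟩ := hb
    refine ⟨c + d, ?_⟩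
    filter_upwards [hc, hd] with j h1 h2
    rw [add_mul, h1, h2, add_smul]
  | smul t a _ ha =>
    obtain ⟨c, hc⟩ := ha
    refine ⟨t * c, ?_⟩
    filter_upwards [hc] with j h1
    rw [smul_mul_assoc, h1, mul_smul]

/-- In the path representation, a monomial carries some basis vector to a basis vector. -/
theorem one_le_norm_monomial {m n : Mor Graph} (h : m.source = n.source) :
    1 ≤ ‖gen m * star (gen n)‖ := by
  obtain ⟨x, hx⟩ := exists_infPath_range m.source
  obtain ⟨y, hy⟩ := isKGraph_graph.exists_concat hx.symm
  obtain ⟨z, hz⟩ := isKGraph_graph.exists_concat (h.symm.trans hx.symm)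
  have h1 := (pathAct isKGraph_graph (gen m * star (gen n))).le_opNorm (delta z)
  rw [pathAct_monomial_delta isKGraph_graph hy hz, norm_delta, norm_delta, mul_one] at h1
  exact h1.trans (norm_pathAct_le _ _)

theorem not_exists_isCondExp : ¬ ∃ P : CStar Graph →ₗ[ℂ] CStar Graph,
    CStarSub.IsCondExp (cyclineAlgebra isKGraph_graph isRowFinite_graph) P := by
  rintro ⟨P, hP⟩
  set a : CStar Graph := gen (ePath ![1, 0]) * star (gen (ePath ![0, 1]))
  have hPa : P a ∈ closure (pairSpan (L := Graph) IsCycline : Set (CStar Graph)) := by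
    have h := hP.map_mem a
    rw [← SetLike.mem_coe, coe_cyclineAlgebra, cyclineSpan_eq] at h
    exact h
  obtain ⟨m, hm, hdist⟩ := Metric.mem_closure_iff.1 hPa (1 / 4) (by norm_num)
  obtain ⟨c, hc⟩ := exists_eventually_mul_proj_eq hm
  obtain ⟨j, hj⟩ := hc.exists
  set p := proj (alphaPath ![j, j + 1])
  have hcyc {q : Fin 2 → ℕ} (h : q 0 + q 1 = j + (j + 1)) :
      gen (alphaPath q) * star (gen (alphaPath ![j, j + 1])) ∈
        cyclineAlgebra isKGraph_graph isRowFinite_graph :=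
    monomial_mem_cyclineAlgebra _ _ (isCycline_alphaPath h)
  have hp : p ∈ cyclineAlgebra isKGraph_graph isRowFinite_graph := hcyc rfl
  have e1 : ![j + 1, j] = ![1, 0] + ![j, j] := by
    refine funext (Fin.forall_fin_two.2 ⟨?_, ?_⟩) <;> simp [add_comm]
  have e2 : ![j, j + 1] = ![0, 1] + ![j, j] := by
    refine funext (Fin.forall_fin_two.2 ⟨?_, ?_⟩) <;> simp [add_comm]
  -- The pair of `t` is cycline, so that `t = P t = P (a p) = P a p`.
  set t := gen (alphaPath ![j + 1, j]) * star (gen (alphaPath ![j, j + 1]))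
  have hap : a * p = t := by
    simp only [a, p, t, proj, mul_assoc]
    rw [e1, gen_alphaPath_add, mul_assoc, ← mul_assoc (star _) (gen _), e2,
      star_gen_mul_gen_alphaPath_add]
  have ht : P a * p = t := by
    rw [← hP.map_mul_right p hp, hap]
    exact hP.map_of_mem t (hcyc (add_right_comm j 1 j))
  -- `t` is close to a multiple of the projection `p`, but the two have different degrees
  have h1 : ‖t - c • p‖ ≤ 1 / 4 := by
    rw [← ht, ← hj, ← sub_mul]
    refine (norm_mul_le _ _).trans ?_
    rw [← dist_eq_norm]
    exact (mul_le_of_le_one_right dist_nonneg (norm_proj_le _)).trans hdist.le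
  have h2 := (norm_spectral_le isKGraph_graph isRowFinite_graph 0 (t - c • p)).trans h1
  have h3 : spectral isKGraph_graph isRowFinite_graph 0 t = 0 := by
    refine (spectral_monomial _ _ _ _ _).trans (if_neg fun h => ?_)
    have h0 := congrFun h 0
    simp [Mor.intDegree, degree_alphaPath] at h0
  have h4 : spectral isKGraph_graph isRowFinite_graph 0 p = p :=
    (spectral_monomial _ _ _ _ _).trans (if_pos (sub_self _))
  rw [map_sub, map_smul, h3, h4, zero_sub, norm_neg] at h2
  have h5 : 1 ≤ ‖t‖ := one_le_norm_monomial rfl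
  have h6 := norm_le_norm_sub_add t (c • p)
  linarith

end Example

end

theorem mainTheorem8 :
    -- the category presented by the factorisation rules is a row-finite 2-graph with no sources
    KGraph.IsKGraph Example.Graph ∧
    KGraph.IsRowFinite Example.Graph ∧
    KGraph.HasNoSources Example.Graph ∧
    -- and its paths of degree `(1, 0)` and `(0, 1)` are the given blue and red edges
    (∀ c : Example.Colour, Set.BijOn Example.ofEdge {t | t.2.2.colour = c}
      {m : KGraph.Mor Example.Graph | m.degree = c.degree}) ∧
    ¬ IsClosed (interior (KGraph.isotropy Example.Graph)) ∧
    ∃ M : NonUnitalStarSubalgebra ℂ (KGraph.CStar Example.Graph),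
      (M : Set (KGraph.CStar Example.Graph)) = KGraph.cyclineSpan Example.Graph ∧
      CStarSub.IsMaximalAbelian M ∧
      (¬ ∃ P : KGraph.CStar Example.Graph →ₗ[ℂ] KGraph.CStar Example.Graph,
        CStarSub.IsCondExp M P) ∧
      ¬ CStarSub.IsCartan M := by
  open Example in
  exact ⟨isKGraph_graph, isRowFinite_graph, hasNoSources_graph, bijOn_ofEdge,
    not_isClosed_interior_isotropy, KGraph.cyclineAlgebra isKGraph_graph isRowFinite_graph,
    KGraph.coe_cyclineAlgebra _ _,
    KGraph.isMaximalAbelian_cyclineAlgebra _ _ exists_infPath_range, not_exists_isCondExp,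
    fun h => not_exists_isCondExp (h.condExp.imp fun _ hP => hP.1)⟩
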